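/- Let $K\ge 1$, $d,n\ge 0$, let $(X,Y)$ be a random pair with values in $[0,1]^d\times\{1,\dots,K\}$ and arbitrary distribution, and let $(X_t,Y_t)_{t\ge1}$ be iid copies of $(X,Y)$, independent of a holdout sample $\mathcal D_0$ of $n$ labelled observations. Put $\mathcal F_t=\sigma(\mathcal D_0,(X_k,Y_k)_{1\le k\le t})$, $\bar V(x,y)=\mathbb P(Y=y\mid X=x)$ and $W(x)=\max_{y}\bar V(x,y)$. Assume that $W(X)$ has a density which vanishes outside $[\kappa,B^*]$, is continuous on $[\kappa,B^*]$ and is positive on $(\kappa,B^*)$, where $1/K\le\kappa<B^*\le1$. Let $\bar V_t(x,y)\in[0,1]$, $t\ge1$, be estimators of $\bar V(x,y)$, where $\bar V_t(\cdot,\cdot)$ is $\mathcal F_{t-1}$-measurable (jointly in the sample and $x$), such that for some $C_1>0$, $\nu_0>0$, $\nu\in(0,1/2]$ and all $t$ large enough, $$\mathbb P\Big(\mathbb E\big[\max_{y}|\bar V_t(X_t,y)-\bar V(X_t,y)|\,\big|\,\mathcal F_{t-1}\big]\ge C_1(\log t)^{\nu_0}t^{-\nu}\Big)\le\frac{3}{\pi^2t^3}.$$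 Let $\alpha\in(0,1)$ with $1-B^*<\alpha<1-\mathbb E[W(X)]$, let $\gamma_j=c\,j^{-\beta}$ with $c>0$ and $\beta\in(1/2,1)$, and let $q_1\in[0,1-\alpha]$. The OnlineSCI selective classification method predicts $\hat Y_t(X_t)=\arg\max_y\bar V_t(X_t,y)$ (the smallest maximiser in case of ties), selects according to $S_t(X_t)=\mathbf 1\{\max_y\bar V_t(X_t,y)>q_t\}$, and updates its threshold by $$q_{t+1}=q_t+\gamma_{J(t)}\big(\mathbf 1\{q_t<0\}+\mathbf 1\{q_t\ge0\}\mathbf 1\{Y_t\ne\hat Y_t(X_t)\}-\alpha\big)S_t(X_t),\qquad J(t)=1+\sum_{i=1}^{t-1}S_i(X_i).$$ Let $\mathrm{IER}_t=\mathbb P(Y_t\neq\hat Y_t(X_t)\mid S_t(X_t)=1,\mathcal F_{t-1})$ be its instantaneous error rate (equal to $0$ by convention where $\mathbb P(S_t(X_t)=1\mid\mathcal F_{t-1})=0$), let $$\delta=\inf_{q\in[0,B^*)}\ \inf_{t\ge1}\ \mathbb P\Big(\sup_{T\ge t}q_T>q\Big),$$ and let $\rho(t)=(\log t)^{1/2}t^{1/2-\beta}+t^{\beta-1}$.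 Then there is exactly one $q^0_\alpha\in(\kappa,1-\alpha)$ with $\mathbb E[W(X)\mid W(X)>q^0_\alpha]=1-\alpha$, and for every $\delta'>\delta$ there exist $T_0=T_0(\delta')\ge1$ and $C_0=C_0(\delta')>0$ (which may depend on everything except $t$) such that for all $t\ge T_0$, $$\mathbb P\Big(|\mathrm{IER}_t-\alpha|+|q_t-q^0_\alpha|\le C_0\big(\rho(t)+(\log t)^{\nu_0/2}t^{-\nu/2}\big)\Big)\ \ge\ 1-\delta'-\frac{C_0}{t}.$$ -/

import Mathlib

open MeasureTheory ProbabilityTheory Set Filter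

noncomputable section

namespace OnlineSCI

/-- The feature space `[0,1]^d`. -/
abbrev Feature (d : ℕ) : Type := Fin d → unitInterval

/-- `P(Y = y | X = x)` for `(X, Y) ∼ P`, through the regular conditional law of `Y` given `X`. -/
def classProb {d K : ℕ} [NeZero K] (P : Measure (Feature d × Fin K)) [IsFiniteMeasure P]
    (x : Feature d) (y : Fin K) : ℝ :=
  (P.condKernel x).real {y}

/-- `max_y v(y)`. -/
def maxScore {K : ℕ} [NeZero K] (v : Fin K → ℝ) : ℝ :=
  Finset.univ.sup' Finset.univ_nonempty v

open Classical in
/-- The smallest maximiser of `v`. -/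
def argmaxLabel {K : ℕ} [NeZero K] (v : Fin K → ℝ) : Fin K :=
  (Finset.univ.filter fun y => ∀ y', v y' ≤ v y).min' (by
    obtain ⟨y, hy⟩ := Finite.exists_max v
    exact ⟨y, by simpa using hy⟩)

/-- `W(x) = max_y P(Y = y | X = x)`. -/
def topProb {d K : ℕ} [NeZero K] (P : Measure (Feature d × Fin K)) [IsFiniteMeasure P]
    (x : Feature d) : ℝ :=
  maxScore (classProb P x)

/-- `ν` has a density on `ℝ` that vanishes outside `[a,b]`, is continuous on `[a,b]` and is
positive on `(a,b)`. -/
def HasContinuousDensityOn (ν : Measure ℝ) (a b : ℝ) : Prop :=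
  ∃ g : ℝ → ℝ, ContinuousOn g (Icc a b) ∧ (∀ w ∈ Ioo a b, 0 < g w) ∧
    ν = (volume.restrict (Icc a b)).withDensity fun w => ENNReal.ofReal (g w)

/-- `E[W(X) | W(X) > q]`. -/
def condMeanTop {d K : ℕ} [NeZero K] (P : Measure (Feature d × Fin K)) [IsFiniteMeasure P]
    (q : ℝ) : ℝ :=
  ∫ z, topProb P z.1 ∂(ProbabilityTheory.cond P {z | q < topProb P z.1})

/-- `F_t = σ(D₀, (X_k, Y_k), 1 ≤ k ≤ t)`. -/
abbrev history {Ω : Type*} {d K n : ℕ} (D0 : Ω → Fin n → Feature d × Fin K)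
    (X : ℕ → Ω → Feature d) (Y : ℕ → Ω → Fin K) (t : ℕ) : MeasurableSpace Ω :=
  MeasurableSpace.comap D0 inferInstance ⊔
    ⨆ k ∈ Icc 1 t, MeasurableSpace.comap (fun ω => (X k ω, Y k ω)) inferInstance

/-- One round of the algorithm. The state is `(q, J)`, with `J` one plus the number of selections
made so far, `v` is the vector of estimated class probabilities at the current feature and `y` is
the current label. If `max v > q` the point is selected, and then `q` increases by `γ_J (1 - α)`
when `q < 0` or the predicted class is wrong, and decreases by `γ_J α` otherwise. -/
def sciStep {K : ℕ} [NeZero K] (α : ℝ) (γ : ℕ → ℝ) (v : Fin K → ℝ) (y : Fin K)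
    (s : ℝ × ℕ) : ℝ × ℕ :=
  open Classical in
  if s.1 < maxScore v then
    (s.1 + γ s.2 * ((if s.1 < 0 ∨ y ≠ argmaxLabel v then 1 else 0) - α), s.2 + 1)
  else s

/-- The state `(q_t, J(t))` at the beginning of round `t`, for `t ≥ 1`. The value at `t = 0` is a
placeholder. -/
def sciState {Ω : Type*} {d K : ℕ} [NeZero K] (α : ℝ) (γ : ℕ → ℝ) (q₁ : ℝ)
    (est : ℕ → Ω → Feature d → Fin K → ℝ) (X : ℕ → Ω → Feature d) (Y : ℕ → Ω → Fin K) :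
    ℕ → Ω → ℝ × ℕ
  | 0, _ => (q₁, 1)
  | 1, _ => (q₁, 1)
  | t + 2, ω =>
      sciStep α γ (est (t + 1) ω (X (t + 1) ω)) (Y (t + 1) ω) (sciState α γ q₁ est X Y (t + 1) ω)

/-- The threshold `q_t`. -/
def threshold {Ω : Type*} {d K : ℕ} [NeZero K] (α : ℝ) (γ : ℕ → ℝ) (q₁ : ℝ)
    (est : ℕ → Ω → Feature d → Fin K → ℝ) (X : ℕ → Ω → Feature d) (Y : ℕ → Ω → Fin K)
    (t : ℕ) (ω : Ω) : ℝ :=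
  (sciState α γ q₁ est X Y t ω).1

/-- The event `S_t(X_t) = 1` that round `t` is selected when the thresholds are `q`. -/
def selectedEvent {Ω : Type*} {d K : ℕ} [NeZero K] (est : ℕ → Ω → Feature d → Fin K → ℝ)
    (X : ℕ → Ω → Feature d) (q : ℕ → Ω → ℝ) (t : ℕ) : Set Ω :=
  {ω | q t ω < maxScore (est t ω (X t ω))}

/-- The event `Y_t ≠ Ŷ_t(X_t)` that the prediction of round `t` is wrong. -/
def errorEvent {Ω : Type*} {d K : ℕ} [NeZero K] (est : ℕ → Ω → Feature d → Fin K → ℝ)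
    (X : ℕ → Ω → Feature d) (Y : ℕ → Ω → Fin K) (t : ℕ) : Set Ω :=
  {ω | Y t ω ≠ argmaxLabel (est t ω (X t ω))}

/-- The conditional probability `P(A | S, 𝓖)` given an event `S` and a σ-algebra `𝓖`, that is
`P(A ∩ S | 𝓖) / P(S | 𝓖)`, with value `0` where `P(S | 𝓖) = 0`. -/
def condProbGiven {Ω : Type*} [MeasurableSpace Ω] (μ : Measure Ω) (𝓖 : MeasurableSpace Ω)
    (A S : Set Ω) (ω : Ω) : ℝ :=
  (μ[(A ∩ S).indicator (fun _ => (1 : ℝ)) | 𝓖]) ω / (μ[S.indicator (fun _ => (1 : ℝ)) | 𝓖]) ω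

/-- The instantaneous error rate `P(Y_t ≠ Ŷ_t(X_t) | S_t(X_t) = 1, F_{t-1})`, for `t ≥ 1`. -/
def instErrorRate {Ω : Type*} [MeasurableSpace Ω] (μ : Measure Ω) {d K n : ℕ} [NeZero K]
    (D0 : Ω → Fin n → Feature d × Fin K) (est : ℕ → Ω → Feature d → Fin K → ℝ)
    (X : ℕ → Ω → Feature d) (Y : ℕ → Ω → Fin K) (q : ℕ → Ω → ℝ) (t : ℕ) (ω : Ω) : ℝ :=
  condProbGiven μ (history D0 X Y (t - 1)) (errorEvent est X Y t) (selectedEvent est X q t) ω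

/-- The incompressible failure probability
`inf_{b ∈ [0, B*)} inf_{t ≥ 1} P(sup_{T ≥ t} q_T > b)`. -/
def failureProb {Ω : Type*} [MeasurableSpace Ω] (μ : Measure Ω) (q : ℕ → Ω → ℝ) (Bstar : ℝ) : ℝ :=
  sInf {p | ∃ b ∈ Ico 0 Bstar, ∃ t : ℕ, 1 ≤ t ∧ p = μ.real {ω | ∃ T : ℕ, t ≤ T ∧ b < q T ω}}

/-- `ρ(t) = (log t)^{1/2} t^{1/2-β} + t^{β-1}`. -/
def rho (β : ℝ) (t : ℕ) : ℝ :=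
  Real.log t ^ (1 / 2 : ℝ) * (t : ℝ) ^ (1 / 2 - β) + (t : ℝ) ^ (β - 1)

end OnlineSCI

end

/-! Write `a = 1 - α` and let `drift ν a q` be the integral of `a - w` over `w > q`, with `ν` the
law of `W(X)`. With exact scores and `0 ≤ q`, this is the conditional mean of one threshold update
divided by its step size, and its zeros below the top of the support are the solutions of `E[W | W >
q] = a`. It is positive at `κ`, strictly decreasing on `(κ, a)`, negative on `[a, B*)` and
Lipschitz. So there is one zero `q₀` in `(κ, a)`, and on each half-line `(-∞, b]` with `b < B*` the
drift at distance `η` from `q₀` is at least `m η` in size and points towards `q₀`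
(`exists_drift_eq_zero`). Above `B*` this pull is lost, which is where `δ` comes from: up to
probability `δ'` the threshold stays below some `b < B*` from some time `t₀` on.

Estimated scores perturb the drift. If their mean error is at most `ε`, selection changes only where
`W` is within `√ε` of the threshold or the score error is at least `√ε`. Both have probability of
order `√ε` (`abs_errMass_sub_le`), whence the halved exponents `ν₀/2` and `ν/2`.

Fix `t` and put `s = ⌊t/4⌋`. On `[s, 2s)` the selection probability is bounded below, so by
Azuma-Hoeffding the counter at `2s` is of order `t` (`le_counter`) and later steps have size of
order `t^{-β}`. On `[2s, t]` the noise accumulated from any starting round is `O(t^{-β} √(t log t))`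
with probability `1 - O(1/t)` (`measure_stepNoise_le`). Take `η` of order `√ε + t^{β-1}`: the first
term dominates the bias, the second lets the drift cover a bounded distance within `t/2` rounds. The
path therefore enters the `η`-band, and after its last visit only one step and the noise can carry
it away (`abs_le_of_pushed`).

The error rate is almost surely a ratio of integrals that differs from `α` by a multiple of the
drift plus the bias, so the bound on the threshold transfers to it. `measure_far_le` collects the
exceptional events. -/

namespace OnlineSCI

/-! ### Conditioning on the past and the Azuma-Hoeffding inequality. -/

section General

variable {Ω : Type*}

/-- If `ζ` is independent of `U` and has law `P`, then the conditional expectation of `f (U, ζ)`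
given `U` is obtained by integrating out `ζ`. -/
theorem condExp_comap_indepFun {Ω' Z : Type*} {m0 : MeasurableSpace Ω} [MeasurableSpace Ω']
    [MeasurableSpace Z] {μ : Measure Ω} [IsProbabilityMeasure μ] {P : Measure Z}
    [IsProbabilityMeasure P] {U : Ω → Ω'} {ζ : Ω → Z} (hU : Measurable U) (hζ : Measurable ζ)
    (hind : IndepFun U ζ μ) (hP : μ.map ζ = P) {f : Ω' × Z → ℝ} (hf : Measurable f) {C : ℝ}
    (hC : ∀ p, |f p| ≤ C) :
    μ[fun ω => f (U ω, ζ ω) | MeasurableSpace.comap U inferInstance]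
      =ᵐ[μ] fun ω => ∫ z, f (U ω, z) ∂P := by
  have hmU : IsProbabilityMeasure (μ.map U) := Measure.isProbabilityMeasure_map hU.aemeasurable
  have hmap : μ.map (fun ω => (U ω, ζ ω)) = (μ.map U).prod P := by
    rw [← hP]
    exact (indepFun_iff_map_prod_eq_prod_map_map hU.aemeasurable hζ.aemeasurable).1 hind
  have hsm : StronglyMeasurable fun u => ∫ z, f (u, z) ∂P :=
    hf.stronglyMeasurable.integral_prod_right'
  have hbd : ∀ u, ‖∫ z, f (u, z) ∂P‖ ≤ C := fun u => by
    simpa using norm_integral_le_of_norm_le_const (μ := P)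
      (f := fun z => f (u, z)) (Eventually.of_forall fun z => hC (u, z))
  have hint : Integrable (fun ω => f (U ω, ζ ω)) μ :=
    Integrable.of_bound (hf.comp (hU.prodMk hζ)).aestronglyMeasurable C
      (Eventually.of_forall fun ω => hC _)
  have hint' : Integrable (fun ω => ∫ z, f (U ω, z) ∂P) μ :=
    Integrable.of_bound (hsm.measurable.comp hU).aestronglyMeasurable C
      (Eventually.of_forall fun ω => hbd _)
  refine (ae_eq_condExp_of_forall_setIntegral_eq hU.comap_le hint
    (fun s _ _ => hint'.integrableOn) ?_ ?_).symm
  · rintro s ⟨A, hA, rfl⟩ -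
    have h1 : ∫ ω in U ⁻¹' A, f (U ω, ζ ω) ∂μ
        = ∫ p, (A ×ˢ univ).indicator f p ∂(μ.map (fun ω => (U ω, ζ ω))) := by
      rw [integral_map (hU.prodMk hζ).aemeasurable
        (hf.indicator (hA.prod MeasurableSet.univ)).aestronglyMeasurable,
        ← integral_indicator (hU hA)]
      congr 1 with ω
      by_cases h : U ω ∈ A <;> simp [indicator, h]
    have h2 : ∫ ω in U ⁻¹' A, (∫ z, f (U ω, z) ∂P) ∂μ
        = ∫ u, A.indicator (fun u => ∫ z, f (u, z) ∂P) u ∂(μ.map U) := by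
      rw [integral_map hU.aemeasurable
        (hsm.measurable.indicator hA).aestronglyMeasurable, ← integral_indicator (hU hA)]
      rfl
    rw [h1, h2, hmap, integral_prod]
    · congr 1 with u
      by_cases h : u ∈ A <;> simp [indicator, h]
    · refine Integrable.of_bound
        (hf.indicator (hA.prod MeasurableSet.univ)).aestronglyMeasurable C
        (Eventually.of_forall fun p => ?_)
      exact (norm_indicator_le_norm_self _ _).trans (hC p)
  · exact (hsm.comp_measurable (comap_measurable U)).aestronglyMeasurable

/-- The conditional expectation of `f (·, ζ)` given a σ-algebra `m` that `ζ` is independent of,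
where `f` is jointly measurable in `m` and its second argument. -/
theorem condExp_indep_prod {Z : Type*} {m m0 : MeasurableSpace Ω} [MeasurableSpace Z]
    {μ : Measure Ω} [IsProbabilityMeasure μ] {P : Measure Z} [IsProbabilityMeasure P]
    (hm : m ≤ m0) {ζ : Ω → Z} (hζ : Measurable ζ)
    (hind : Indep m (MeasurableSpace.comap ζ inferInstance) μ) (hP : μ.map ζ = P)
    {f : Ω × Z → ℝ} (hf : Measurable[m.prod inferInstance] f) {C : ℝ} (hC : ∀ p, |f p| ≤ C) :
    μ[fun ω => f (ω, ζ ω) | m] =ᵐ[μ] fun ω => ∫ z, f (ω, z) ∂P := by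
  -- The identity, seen as a map into `Ω` with the smaller σ-algebra `m`, plays the role of `U`.
  have hid : Indep (MeasurableSpace.comap id m) (MeasurableSpace.comap ζ inferInstance) μ := by
    rw [MeasurableSpace.comap_id]; exact hind
  have h := @condExp_comap_indepFun Ω Ω Z m0 m _ μ _ P _ id ζ (measurable_id'' hm) hζ
    hid hP f hf C hC
  rwa [MeasurableSpace.comap_id] at h

variable {m0 : MeasurableSpace Ω} {μ : Measure Ω} [IsProbabilityMeasure μ]

/-- The exponential moment bound behind the Azuma-Hoeffding inequality. -/
theorem integral_exp_sum_le {ℱ : ℕ → MeasurableSpace Ω} (hmono : Monotone ℱ)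
    (hle : ∀ k, ℱ k ≤ m0) {ξ : ℕ → Ω → ℝ} {i : ℕ} {c : ℝ} (hc : 0 < c)
    (hξ : ∀ k, i ≤ k → Measurable[ℱ (k + 1)] (ξ k)) (hbd : ∀ k, i ≤ k → ∀ ω, |ξ k ω| ≤ c)
    (hmean : ∀ k, i ≤ k → μ[ξ k | ℱ k] =ᵐ[μ] 0) (l : ℝ) {j : ℕ} (hij : i ≤ j) :
    ∫ ω, Real.exp (l * ∑ k ∈ Finset.Ico i j, ξ k ω) ∂μ
      ≤ Real.exp (l ^ 2 * c ^ 2 / 2 * (j - i : ℕ)) := by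
  have hmeas : ∀ j, i ≤ j → Measurable[ℱ j] fun ω => ∑ k ∈ Finset.Ico i j, ξ k ω := by
    intro j _
    refine @Finset.measurable_sum _ _ _ _ _ _ (ℱ j) _ _ fun k hk => ?_
    have hk' := Finset.mem_Ico.1 hk
    exact (hξ k hk'.1).mono (hmono hk'.2) le_rfl
  have hsb : ∀ j ω, |∑ k ∈ Finset.Ico i j, ξ k ω| ≤ (j - i : ℕ) * c := by
    intro j ω
    refine (Finset.abs_sum_le_sum_abs _ _).trans ?_
    refine (Finset.sum_le_card_nsmul _ _ c fun k hk => hbd k (Finset.mem_Ico.1 hk).1 ω).trans ?_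
    simp
  induction j, hij using Nat.le_induction with
  | base => simp
  | succ j hij ih =>
    set Φ : Ω → ℝ := fun ω => Real.exp (l * ∑ k ∈ Finset.Ico i j, ξ k ω) with hΦ
    have hΦm : Measurable[ℱ j] Φ :=
      Real.measurable_exp.comp ((hmeas j hij).const_mul l)
    obtain ⟨B, hB⟩ : ∃ B, ∀ ω, ‖Φ ω‖ ≤ B := by
      refine ⟨Real.exp (|l| * ((j - i : ℕ) * c)), fun ω => ?_⟩
      rw [Real.norm_eq_abs, abs_of_pos (Real.exp_pos _)]
      refine Real.exp_le_exp.2 ((le_abs_self _).trans ?_)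
      rw [abs_mul]
      exact mul_le_mul_of_nonneg_left (hsb j ω) (abs_nonneg _)
    have hξm : Measurable[m0] (ξ j) := (hξ j hij).mono (hle _) le_rfl
    have hξi : Integrable (ξ j) μ := Integrable.of_bound hξm.aestronglyMeasurable c
      (Eventually.of_forall fun ω => hbd j hij ω)
    have hΦm0 : Measurable[m0] Φ := hΦm.mono (hle _) le_rfl
    have hΦi : Integrable Φ μ := Integrable.of_bound hΦm0.aestronglyMeasurable B
      (Eventually.of_forall hB)
    have hΦξ : Integrable (fun ω => Φ ω * ξ j ω) μ :=
      hξi.bdd_mul hΦm0.aestronglyMeasurable (Eventually.of_forall hB)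
    have hzero : ∫ ω, Φ ω * ξ j ω ∂μ = 0 := by
      have h1 : μ[Φ * ξ j | ℱ j] =ᵐ[μ] Φ * μ[ξ j | ℱ j] :=
        condExp_stronglyMeasurable_mul_of_bound (hle j) hΦm.stronglyMeasurable hξi B
          (Eventually.of_forall hB)
      have h2 : μ[Φ * ξ j | ℱ j] =ᵐ[μ] 0 := by
        filter_upwards [h1, hmean j hij] with ω h1 h2
        rw [h1, Pi.mul_apply, h2]; simp
      have h3 := integral_condExp (hle j) (f := Φ * ξ j) (μ := μ)
      rw [integral_congr_ae h2] at h3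
      simpa using h3.symm
    -- By convexity the exponential lies below its chord on `[-c, c]`; the part linear in `ξ j`
    -- integrates to zero by `hzero`.
    have hpt : ∀ ω, Real.exp (l * ∑ k ∈ Finset.Ico i (j + 1), ξ k ω)
        ≤ Real.cosh (l * c) * Φ ω + Real.sinh (l * c) / c * (Φ ω * ξ j ω) := by
      intro ω
      rw [Finset.sum_Ico_succ_top hij, mul_add, Real.exp_add]
      have hle1 : |ξ j ω / c| ≤ 1 := by
        rw [abs_div, abs_of_pos hc, div_le_one hc]; exact hbd j hij ω
      have := Real.exp_mul_le_cosh_add_mul_sinh hle1 (l * c)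
      have he : ξ j ω / c * (l * c) = l * ξ j ω := by field_simp
      rw [he] at this
      calc _ ≤ Φ ω * (Real.cosh (l * c) + ξ j ω / c * Real.sinh (l * c)) :=
            mul_le_mul_of_nonneg_left this (Real.exp_pos _).le
        _ = _ := by ring
    have hleft : Integrable (fun ω => Real.exp (l * ∑ k ∈ Finset.Ico i (j + 1), ξ k ω)) μ := by
      refine Integrable.of_bound (Real.measurable_exp.comp
        (((hmeas (j + 1) (by omega)).mono (hle _) le_rfl).const_mul l)).aestronglyMeasurable
        (Real.exp (|l| * ((j + 1 - i : ℕ) * c))) (Eventually.of_forall fun ω => ?_)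
      rw [Real.norm_eq_abs, abs_of_pos (Real.exp_pos _)]
      refine Real.exp_le_exp.2 ((le_abs_self _).trans ?_)
      rw [abs_mul]
      exact mul_le_mul_of_nonneg_left (hsb (j + 1) ω) (abs_nonneg _)
    calc _ ≤ ∫ ω, (Real.cosh (l * c) * Φ ω + Real.sinh (l * c) / c * (Φ ω * ξ j ω)) ∂μ :=
          integral_mono hleft ((hΦi.const_mul _).add (hΦξ.const_mul _)) hpt
      _ = Real.cosh (l * c) * ∫ ω, Φ ω ∂μ := by
          rw [integral_add (hΦi.const_mul _) (hΦξ.const_mul _), integral_const_mul,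
            integral_const_mul, hzero]
          ring
      _ ≤ Real.exp ((l * c) ^ 2 / 2) * Real.exp (l ^ 2 * c ^ 2 / 2 * (j - i : ℕ)) :=
          mul_le_mul (Real.cosh_le_exp_half_sq _) ih (integral_nonneg fun ω => (Real.exp_pos _).le)
            (Real.exp_pos _).le
      _ = _ := by
          rw [← Real.exp_add, Nat.succ_sub hij]
          congr 1
          push_cast
          ring

/-- The one-sided Azuma-Hoeffding inequality for bounded martingale differences. -/
theorem measure_sum_ge_le {ℱ : ℕ → MeasurableSpace Ω} (hmono : Monotone ℱ)
    (hle : ∀ k, ℱ k ≤ m0) {ξ : ℕ → Ω → ℝ} {i : ℕ} {c : ℝ} (hc : 0 < c)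
    (hξ : ∀ k, i ≤ k → Measurable[ℱ (k + 1)] (ξ k)) (hbd : ∀ k, i ≤ k → ∀ ω, |ξ k ω| ≤ c)
    (hmean : ∀ k, i ≤ k → μ[ξ k | ℱ k] =ᵐ[μ] 0) {j : ℕ} {N : ℝ} (hN : 0 < N)
    (hij : i ≤ j) (hjN : ((j - i : ℕ) : ℝ) ≤ N) {x : ℝ} (hx : 0 ≤ x) :
    μ.real {ω | x ≤ ∑ k ∈ Finset.Ico i j, ξ k ω} ≤ Real.exp (-(x ^ 2 / (2 * c ^ 2 * N))) := by
  -- The minimiser of the Chernoff exponent `l² c² N / 2 - l x`.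
  set l : ℝ := x / (c ^ 2 * N) with hl
  have hl0 : 0 ≤ l := by positivity
  have hmeas : Measurable fun ω => Real.exp (l * ∑ k ∈ Finset.Ico i j, ξ k ω) := by
    refine Real.measurable_exp.comp (Measurable.const_mul ?_ l)
    refine Finset.measurable_sum _ fun k hk => ?_
    exact (hξ k (Finset.mem_Ico.1 hk).1).mono (hle _) le_rfl
  have hint : Integrable (fun ω => Real.exp (l * ∑ k ∈ Finset.Ico i j, ξ k ω)) μ := by
    refine Integrable.of_bound hmeas.aestronglyMeasurable
      (Real.exp (l * ((j - i : ℕ) * c))) (Eventually.of_forall fun ω => ?_)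
    rw [Real.norm_eq_abs, abs_of_pos (Real.exp_pos _)]
    refine Real.exp_le_exp.2 (mul_le_mul_of_nonneg_left ?_ hl0)
    refine (Finset.sum_le_card_nsmul _ _ c fun k hk =>
      (le_abs_self _).trans (hbd k (Finset.mem_Ico.1 hk).1 ω)).trans ?_
    simp
  have h1 := mul_meas_ge_le_integral_of_nonneg (μ := μ)
    (Eventually.of_forall fun ω => (Real.exp_pos (l * ∑ k ∈ Finset.Ico i j, ξ k ω)).le) hint
    (Real.exp (l * x))
  have h2 := integral_exp_sum_le hmono hle hc hξ hbd hmean l hij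
  have h3 : μ.real {ω | x ≤ ∑ k ∈ Finset.Ico i j, ξ k ω}
      ≤ μ.real {ω | Real.exp (l * x) ≤ Real.exp (l * ∑ k ∈ Finset.Ico i j, ξ k ω)} := by
    refine measureReal_mono fun ω hω => ?_
    exact Real.exp_le_exp.2 (mul_le_mul_of_nonneg_left hω hl0)
  have h4 : Real.exp (l ^ 2 * c ^ 2 / 2 * (j - i : ℕ)) ≤ Real.exp (l ^ 2 * c ^ 2 / 2 * N) :=
    Real.exp_le_exp.2 (mul_le_mul_of_nonneg_left hjN (by positivity))
  have h5 : Real.exp (l * x) * μ.real {ω | x ≤ ∑ k ∈ Finset.Ico i j, ξ k ω}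
      ≤ Real.exp (l ^ 2 * c ^ 2 / 2 * N) :=
    (mul_le_mul_of_nonneg_left h3 (Real.exp_pos _).le).trans (h1.trans (h2.trans h4))
  have h6 : Real.exp (l ^ 2 * c ^ 2 / 2 * N)
      = Real.exp (l * x) * Real.exp (-(x ^ 2 / (2 * c ^ 2 * N))) := by
    rw [← Real.exp_add]
    congr 1
    rw [hl]
    field_simp
    ring
  rw [h6] at h5
  exact le_of_mul_le_mul_left h5 (Real.exp_pos _)

/-- The two-sided Azuma-Hoeffding inequality for bounded martingale differences. -/
theorem measure_abs_sum_ge_le {ℱ : ℕ → MeasurableSpace Ω} (hmono : Monotone ℱ)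
    (hle : ∀ k, ℱ k ≤ m0) {ξ : ℕ → Ω → ℝ} {i : ℕ} {c : ℝ} (hc : 0 < c)
    (hξ : ∀ k, i ≤ k → Measurable[ℱ (k + 1)] (ξ k)) (hbd : ∀ k, i ≤ k → ∀ ω, |ξ k ω| ≤ c)
    (hmean : ∀ k, i ≤ k → μ[ξ k | ℱ k] =ᵐ[μ] 0) {j : ℕ} {N : ℝ} (hN : 0 < N)
    (hij : i ≤ j) (hjN : ((j - i : ℕ) : ℝ) ≤ N) {x : ℝ} (hx : 0 ≤ x) :
    μ.real {ω | x ≤ |∑ k ∈ Finset.Ico i j, ξ k ω|}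
      ≤ 2 * Real.exp (-(x ^ 2 / (2 * c ^ 2 * N))) := by
  have h1 := measure_sum_ge_le hmono hle hc hξ hbd hmean hN hij hjN hx
  have h2 := measure_sum_ge_le (μ := μ) hmono hle (ξ := fun k ω => -ξ k ω) hc
    (fun k hk => (hξ k hk).neg) (fun k hk ω => by rw [abs_neg]; exact hbd k hk ω)
    (fun k hk => by
      have h := condExp_neg (μ := μ) (ξ k) (ℱ k)
      filter_upwards [h, hmean k hk] with ω h h'
      have e : (fun ω => -ξ k ω) = -ξ k := rfl
      rw [e, h, Pi.neg_apply, h']; simp) hN hij hjN hx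
  have h3 : {ω | x ≤ |∑ k ∈ Finset.Ico i j, ξ k ω|}
      ⊆ {ω | x ≤ ∑ k ∈ Finset.Ico i j, ξ k ω} ∪ {ω | x ≤ ∑ k ∈ Finset.Ico i j, -ξ k ω} := by
    intro ω hω
    simp only [mem_ofPred_eq, mem_union, Finset.sum_neg_distrib] at hω ⊢
    exact le_abs.1 hω
  calc _ ≤ _ := measureReal_mono h3
    _ ≤ _ := measureReal_union_le _ _
    _ ≤ _ := by linarith

end General

/-! ### Independence of the past from the current round. -/

section Independence

variable {Ω : Type*}

/-- If `m₁` is independent of `m₂ ⊔ m₃` and `m₂` of `m₃`, then `m₁ ⊔ m₂` is independent of `m₃`. -/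
theorem indep_sup_left {m₁ m₂ m₃ m0 : MeasurableSpace Ω} {μ : Measure Ω} [IsProbabilityMeasure μ]
    (h₁ : m₁ ≤ m0) (h₂ : m₂ ≤ m0) (h₃ : m₃ ≤ m0) (h : Indep m₁ (m₂ ⊔ m₃) μ)
    (h' : Indep m₂ m₃ μ) : Indep (m₁ ⊔ m₂) m₃ μ := by
  -- Intersections `A ∩ B` form a π-system generating `m₁ ⊔ m₂`, so the product formula need only be
  -- checked on them.
  let p : Set (Set Ω) := {s | ∃ A B, MeasurableSet[m₁] A ∧ MeasurableSet[m₂] B ∧ s = A ∩ B}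
  have hp : IsPiSystem p := by
    rintro _ ⟨A, B, hA, hB, rfl⟩ _ ⟨A', B', hA', hB', rfl⟩ -
    exact ⟨A ∩ A', B ∩ B', hA.inter hA', hB.inter hB', by ext; simp; tauto⟩
  have hgen : m₁ ⊔ m₂ = MeasurableSpace.generateFrom p := by
    refine le_antisymm (sup_le ?_ ?_) (MeasurableSpace.generateFrom_le ?_)
    · intro A hA
      exact MeasurableSpace.measurableSet_generateFrom
        ⟨A, univ, hA, MeasurableSet.univ, (inter_univ A).symm⟩
    · intro B hB
      exact MeasurableSpace.measurableSet_generateFrom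
        ⟨univ, B, MeasurableSet.univ, hB, (univ_inter B).symm⟩
    · rintro _ ⟨A, B, hA, hB, rfl⟩
      exact MeasurableSet.inter ((le_sup_left : m₁ ≤ m₁ ⊔ m₂) A hA)
        ((le_sup_right : m₂ ≤ m₁ ⊔ m₂) B hB)
  refine IndepSets.indep (sup_le h₁ h₂) h₃ hp (@MeasurableSpace.isPiSystem_measurableSet Ω m₃)
    hgen (@MeasurableSpace.generateFrom_measurableSet Ω m₃).symm ?_
  rw [IndepSets_iff]
  rintro _ C ⟨A, B, hA, hB, rfl⟩ hC
  have hBs : MeasurableSet[m₂ ⊔ m₃] B := (le_sup_left : m₂ ≤ m₂ ⊔ m₃) B hB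
  have hCs : MeasurableSet[m₂ ⊔ m₃] C := (le_sup_right : m₃ ≤ m₂ ⊔ m₃) C hC
  rw [Indep_iff] at h h'
  rw [inter_assoc, h A (B ∩ C) hA (hBs.inter hCs), h' B C hB hC, h A B hA hBs, mul_assoc]

end Independence

section History

variable {Ω : Type*} {d K n : ℕ} {D0 : Ω → Fin n → Feature d × Fin K}
  {X : ℕ → Ω → Feature d} {Y : ℕ → Ω → Fin K}

theorem history_mono : Monotone (history D0 X Y) := fun _ _ hst =>
  sup_le_sup_left (biSup_mono fun _ hk => ⟨hk.1, hk.2.trans hst⟩) _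

theorem measurable_pair_history {t : ℕ} (ht : 1 ≤ t) :
    Measurable[history D0 X Y t] fun ω => (X t ω, Y t ω) := by
  have h : MeasurableSpace.comap (fun ω => (X t ω, Y t ω)) inferInstance ≤ history D0 X Y t :=
    le_sup_of_le_right
      (le_biSup (fun k => MeasurableSpace.comap (fun ω => (X k ω, Y k ω)) inferInstance)
        (⟨ht, le_rfl⟩ : t ∈ Icc 1 t))
  exact (comap_measurable _).mono h le_rfl

variable [m0 : MeasurableSpace Ω]

theorem history_le (hX : ∀ t, 1 ≤ t → Measurable (X t)) (hY : ∀ t, 1 ≤ t → Measurable (Y t))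
    (hD0 : Measurable D0) (t : ℕ) : history D0 X Y t ≤ m0 :=
  sup_le hD0.comap_le (iSup₂_le fun k hk => ((hX k hk.1).prodMk (hY k hk.1)).comap_le)

/-- The holdout sample is independent of the whole sequence and the past rounds are independent of
the current one; `indep_sup_left` combines the two. -/
theorem indep_history {μ : Measure Ω} [IsProbabilityMeasure μ]
    (hX : ∀ t, 1 ≤ t → Measurable (X t)) (hY : ∀ t, 1 ≤ t → Measurable (Y t))
    (hD0 : Measurable D0)
    (hindep : iIndepFun (fun (t : ℕ) ω => (X (t + 1) ω, Y (t + 1) ω)) μ)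
    (hindepD0 : IndepFun D0 (fun ω (t : ℕ) => (X (t + 1) ω, Y (t + 1) ω)) μ)
    {t : ℕ} (ht : 1 ≤ t) :
    Indep (history D0 X Y (t - 1))
      (MeasurableSpace.comap (fun ω => (X t ω, Y t ω)) inferInstance) μ := by
  obtain ⟨t, rfl⟩ : ∃ s, t = s + 1 := ⟨t - 1, by omega⟩
  set Z : ℕ → Ω → Feature d × Fin K := fun k ω => (X (k + 1) ω, Y (k + 1) ω) with hZ
  have hZm : ∀ k, MeasurableSpace.comap (Z k) inferInstance ≤ m0 := fun k =>
    ((hX _ (by omega)).prodMk (hY _ (by omega))).comap_le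
  have hpast : (⨆ k ∈ Icc 1 t, MeasurableSpace.comap (fun ω => (X k ω, Y k ω)) inferInstance)
      ≤ ⨆ k ∈ Iio t, MeasurableSpace.comap (Z k) inferInstance := by
    refine iSup₂_le fun k hk => ?_
    obtain ⟨j, rfl⟩ : ∃ j, k = j + 1 := ⟨k - 1, by have := hk.1; omega⟩
    exact le_biSup (fun k => MeasurableSpace.comap (Z k) inferInstance)
      (show j ∈ Iio t from Nat.lt_of_succ_le hk.2)
  have h23 := indep_iSup_of_disjoint (S := Iio t) (T := {t}) hZm
    ((iIndepFun_iff_iIndep ..).1 hindep) (by simp)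
  simp only [mem_singleton_iff, iSup_iSup_eq_left] at h23
  have hseq : ∀ k, MeasurableSpace.comap (Z k) inferInstance
      ≤ MeasurableSpace.comap (fun ω k => Z k ω) inferInstance := by
    intro k
    have : Z k = (fun z : ℕ → Feature d × Fin K => z k) ∘ fun ω k => Z k ω := rfl
    rw [this, ← MeasurableSpace.comap_comp]
    exact MeasurableSpace.comap_mono (measurable_pi_apply k).comap_le
  have h1 : Indep (MeasurableSpace.comap D0 inferInstance)
      ((⨆ k ∈ Iio t, MeasurableSpace.comap (Z k) inferInstance) ⊔
        MeasurableSpace.comap (Z t) inferInstance) μ :=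
    indep_of_indep_of_le_right ((IndepFun_iff_Indep ..).1 hindepD0)
      (sup_le (iSup₂_le fun k _ => hseq k) (hseq t))
  exact indep_of_indep_of_le_left
    (indep_sup_left hD0.comap_le (iSup₂_le fun k _ => hZm k) (hZm t) h1 h23)
    (sup_le_sup_left hpast _)

end History

/-! ### Maximal scores and predicted labels. -/

section Labels

variable {K : ℕ} [NeZero K]

theorem le_maxScore (v : Fin K → ℝ) (y : Fin K) : v y ≤ maxScore v :=
  Finset.le_sup' v (Finset.mem_univ y)

theorem maxScore_le {v : Fin K → ℝ} {a : ℝ} (h : ∀ y, v y ≤ a) : maxScore v ≤ a :=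
  Finset.sup'_le _ _ fun y _ => h y

theorem le_argmaxLabel (v : Fin K → ℝ) (y : Fin K) : v y ≤ v (argmaxLabel v) := by
  classical
  have h := Finset.min'_mem (Finset.univ.filter fun y => ∀ y', v y' ≤ v y) (by
    obtain ⟨y, hy⟩ := Finite.exists_max v
    exact ⟨y, by simpa using hy⟩)
  have h' := (Finset.mem_filter.1 h).2 y
  convert h'
  unfold argmaxLabel
  congr!

theorem maxScore_eq_argmaxLabel (v : Fin K → ℝ) : maxScore v = v (argmaxLabel v) :=
  le_antisymm (maxScore_le (le_argmaxLabel v)) (le_maxScore v _)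

/-- This reduces the event to finitely many comparisons of coordinates, which gives measurability of
the predicted label. -/
theorem argmaxLabel_eq_iff (v : Fin K → ℝ) (y : Fin K) :
    argmaxLabel v = y ↔ (∀ y', v y' ≤ v y) ∧ ∀ y', (∀ z, v z ≤ v y') → y ≤ y' := by
  classical
  have hmin : ∀ y', (∀ z, v z ≤ v y') → argmaxLabel v ≤ y' := fun y' hy' => by
    refine Finset.min'_le _ _ ?_
    simpa using hy'
  constructor
  · rintro rfl
    exact ⟨le_argmaxLabel v, hmin⟩
  · rintro ⟨h1, h2⟩
    exact le_antisymm (hmin y h1) (h2 _ (le_argmaxLabel v))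

theorem measurable_maxScore : Measurable (maxScore (K := K)) := by
  have : maxScore (K := K) = Finset.univ.sup' Finset.univ_nonempty fun y v => v y := by
    ext v; simp [maxScore]
  rw [this]
  exact Finset.measurable_sup' _ fun y _ => measurable_pi_apply y

theorem measurable_argmaxLabel : Measurable (argmaxLabel (K := K)) := by
  refine measurable_to_countable' fun y => ?_
  have : argmaxLabel (K := K) ⁻¹' {y}
      = {v | (∀ y', v y' ≤ v y) ∧ ∀ y', (∀ z, v z ≤ v y') → y ≤ y'} := by
    ext v; exact argmaxLabel_eq_iff v y
  rw [this]
  have h : ∀ y : Fin K, Measurable fun v : Fin K → ℝ => ∀ y', v y' ≤ v y := fun y =>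
    Measurable.forall fun y' =>
      measurableSet_setOfPred.1 (measurableSet_le (measurable_pi_apply y') (measurable_pi_apply y))
  refine measurableSet_setOfPred.2 ((h y).and (Measurable.forall fun y' => ?_))
  exact (h y').imp measurable_const

theorem abs_maxScore_sub_le (v w : Fin K → ℝ) :
    |maxScore v - maxScore w| ≤ maxScore fun y => |v y - w y| := by
  have h : ∀ v w : Fin K → ℝ, maxScore v - maxScore w ≤ maxScore fun y => |v y - w y| := by
    intro v w
    rw [sub_le_iff_le_add]
    refine maxScore_le fun y => ?_
    have h1 := le_maxScore (fun y => |v y - w y|) y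
    have h2 := le_maxScore w y
    have h3 := le_abs_self (v y - w y)
    linarith
  refine abs_le.2 ⟨?_, h v w⟩
  have := h w v
  simp only [abs_sub_comm (w _)] at this
  linarith

/-- The regret of following `v`: one uniform error is paid when passing from `max w` to `max v`, and
one when passing from `v` back to `w` at the chosen label. -/
theorem maxScore_sub_argmaxLabel_le (v w : Fin K → ℝ) :
    maxScore w - w (argmaxLabel v) ≤ 2 * maxScore fun y => |v y - w y| := by
  have h1 := abs_maxScore_sub_le v w
  have h2 := le_maxScore (fun y => |v y - w y|) (argmaxLabel v)
  rw [maxScore_eq_argmaxLabel v] at h1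
  have h3 := abs_le.1 h1
  have h4 := abs_le.1 h2
  linarith [h3.1, h4.2]

theorem maxScore_nonneg {v : Fin K → ℝ} (h : ∀ y, 0 ≤ v y) : 0 ≤ maxScore v :=
  (h 0).trans (le_maxScore v 0)

end Labels

/-! ### Integrating out the label. -/

section ClassProb

variable {d K : ℕ} [NeZero K] (P : Measure (Feature d × Fin K)) [IsProbabilityMeasure P]

theorem measurable_classProb (y : Fin K) : Measurable fun x => classProb P x y :=
  (Kernel.measurable_coe P.condKernel (MeasurableSet.singleton y)).ennreal_toReal

theorem measurable_topProb : Measurable (topProb P) :=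
  measurable_maxScore.comp (measurable_pi_lambda _ fun y => measurable_classProb P y)

theorem classProb_nonneg (x : Feature d) (y : Fin K) : 0 ≤ classProb P x y := measureReal_nonneg

theorem classProb_le_one (x : Feature d) (y : Fin K) : classProb P x y ≤ 1 := measureReal_le_one

theorem topProb_nonneg (x : Feature d) : 0 ≤ topProb P x :=
  maxScore_nonneg (classProb_nonneg P x)

theorem topProb_le_one (x : Feature d) : topProb P x ≤ 1 := maxScore_le (classProb_le_one P x)

/-- The probability that the label differs from `a x` is obtained by integrating the conditional
probability of this event given the feature. -/
theorem integral_mul_indicator_ne {a : Feature d → Fin K} (ha : Measurable a)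
    {φ : Feature d → ℝ} (hφ : Measurable φ) {C : ℝ} (hC : ∀ x, |φ x| ≤ C) :
    ∫ z, (φ z.1 * if z.2 ≠ a z.1 then 1 else 0) ∂P
      = ∫ z, φ z.1 * (1 - classProb P z.1 (a z.1)) ∂P := by
  have hne : MeasurableSet {z : Feature d × Fin K | z.2 ≠ a z.1} :=
    (measurableSet_eq_fun measurable_snd (ha.comp measurable_fst)).compl
  have hm1 : Measurable fun z : Feature d × Fin K => φ z.1 * if z.2 ≠ a z.1 then (1 : ℝ) else 0 :=
    (hφ.comp measurable_fst).mul (Measurable.ite hne measurable_const measurable_const)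
  have hcp : Measurable fun x => classProb P x (a x) := by
    have : (fun x => classProb P x (a x)) = fun x => ∑ y, if a x = y then classProb P x y else 0 := by
      ext x; simp
    rw [this]
    exact Finset.measurable_sum _ fun y _ =>
      Measurable.ite (ha (MeasurableSet.singleton y)) (measurable_classProb P y) measurable_const
  have hm2 : Measurable fun x => φ x * (1 - classProb P x (a x)) :=
    hφ.mul (measurable_const.sub hcp)
  have hC0 : ∀ x, |φ x * (1 - classProb P x (a x))| ≤ C := fun x => by
    rw [abs_mul]
    have h1 := classProb_nonneg P x (a x)
    have h2 := classProb_le_one P x (a x)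
    have h3 : |1 - classProb P x (a x)| ≤ 1 := abs_le.2 ⟨by linarith, by linarith⟩
    exact (mul_le_of_le_one_right (abs_nonneg _) h3).trans (hC x)
  have hi1 : Integrable (fun z : Feature d × Fin K => φ z.1 * if z.2 ≠ a z.1 then (1 : ℝ) else 0)
      (P.fst ⊗ₘ P.condKernel) :=
    Integrable.of_bound hm1.aestronglyMeasurable C (Eventually.of_forall fun z => by
      rw [Real.norm_eq_abs, abs_mul]
      refine (mul_le_of_le_one_right (abs_nonneg _) ?_).trans (hC z.1)
      split_ifs <;> simp)
  have hi2 : Integrable (fun z : Feature d × Fin K => φ z.1 * (1 - classProb P z.1 (a z.1)))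
      (P.fst ⊗ₘ P.condKernel) :=
    Integrable.of_bound (hm2.comp measurable_fst).aestronglyMeasurable C
      (Eventually.of_forall fun z => hC0 z.1)
  have hg : ∀ x, (P.condKernel x).real {y | y ≠ a x} = 1 - classProb P x (a x) := fun x => by
    have : {y | y ≠ a x} = ({a x} : Set (Fin K))ᶜ := rfl
    rw [this, measureReal_compl (MeasurableSet.singleton _), probReal_univ]
    rfl
  -- Hiding `classProb P` behind `g` keeps the rewriting of `P` as a disintegration from reaching
  -- inside it.
  obtain ⟨g, hgdef⟩ : ∃ g : Feature d → ℝ, ∀ x, classProb P x (a x) = g x := ⟨_, fun _ => rfl⟩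
  simp only [hgdef] at hi2 hg ⊢
  have hdis : P.fst ⊗ₘ P.condKernel = P := P.disintegrate P.condKernel
  conv_lhs => rw [← hdis]
  conv_rhs => rw [← hdis]
  rw [Measure.integral_compProd hi1, Measure.integral_compProd hi2]
  congr 1 with x
  simp only [integral_const, probReal_univ, one_smul, integral_const_mul]
  congr 1
  have h1 : (fun y : Fin K => if y ≠ a x then (1 : ℝ) else 0) = {y | y ≠ a x}.indicator 1 := by
    ext y; by_cases h : y = a x <;> simp [h]
  rw [h1, integral_indicator_one (toFinite _).measurableSet, hg]

end ClassProb

/-! ### Mass bounds from the density of the top probability. -/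

section Density

variable {ν : Measure ℝ} {κ B : ℝ}

theorem HasContinuousDensityOn.ae_mem (h : HasContinuousDensityOn ν κ B) :
    ∀ᵐ w ∂ν, w ∈ Icc κ B := by
  obtain ⟨g, -, -, rfl⟩ := h
  exact (withDensity_absolutelyContinuous _ _).ae_le (ae_restrict_mem measurableSet_Icc)

theorem HasContinuousDensityOn.exists_upper (h : HasContinuousDensityOn ν κ B) :
    ∃ M : ℝ, 0 < M ∧ ∀ u v : ℝ, u ≤ v → ν.real (Icc u v) ≤ M * (v - u) := by
  obtain ⟨g, hg, -, hν⟩ := h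
  obtain ⟨M, hM⟩ := isCompact_Icc.bddAbove_image hg
  refine ⟨max M 1, by positivity, fun u v huv => ?_⟩
  have h1 : ν (Icc u v) ≤ ENNReal.ofReal (max M 1 * (v - u)) := by
    rw [hν, withDensity_apply _ measurableSet_Icc, Measure.restrict_restrict measurableSet_Icc]
    calc _ ≤ ∫⁻ _ in Icc u v ∩ Icc κ B, ENNReal.ofReal (max M 1) := by
          refine setLIntegral_mono' (measurableSet_Icc.inter measurableSet_Icc) fun w hw => ?_
          exact ENNReal.ofReal_le_ofReal ((hM (mem_image_of_mem g hw.2)).trans (le_max_left _ _))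
      _ = ENNReal.ofReal (max M 1) * volume (Icc u v ∩ Icc κ B) := by simp
      _ ≤ ENNReal.ofReal (max M 1) * volume (Icc u v) := by gcongr; exact inter_subset_left
      _ = _ := by rw [Real.volume_Icc, ← ENNReal.ofReal_mul (by positivity)]
  exact ENNReal.toReal_le_of_le_ofReal (mul_nonneg (by positivity) (by linarith)) h1

/-- The density may vanish at `κ` and `B`, so a positive minimum is available only on compact
subintervals of the open interval. -/
theorem HasContinuousDensityOn.exists_lower [IsFiniteMeasure ν] (h : HasContinuousDensityOn ν κ B) {u v : ℝ}
    (hu : κ < u) (hv : v < B) :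
    ∃ g₀ : ℝ, 0 < g₀ ∧ ∀ s t : ℝ, u ≤ s → s ≤ t → t ≤ v → g₀ * (t - s) ≤ ν.real (Ioc s t) := by
  obtain ⟨g, hg, hpos, hν⟩ := h
  have hsub : Icc u v ⊆ Ioo κ B := fun w hw => ⟨hu.trans_le hw.1, hw.2.trans_lt hv⟩
  obtain ⟨g₀, hg₀, hle⟩ : ∃ g₀ : ℝ, 0 < g₀ ∧ ∀ w ∈ Icc u v, g₀ ≤ g w := by
    rcases (Icc u v).eq_empty_or_nonempty with he | hne
    · exact ⟨1, one_pos, by simp [he]⟩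
    · obtain ⟨w, hw, hmin⟩ := isCompact_Icc.exists_isMinOn hne
        (hg.mono (hsub.trans Ioo_subset_Icc_self))
      exact ⟨g w, hpos w (hsub hw), fun w' hw' => hmin hw'⟩
  refine ⟨g₀, hg₀, fun s t hs hst ht => ?_⟩
  have hst' : Ioc s t ⊆ Icc u v := fun w hw => ⟨hs.trans hw.1.le, hw.2.trans ht⟩
  have h1 : ENNReal.ofReal (g₀ * (t - s)) ≤ ν (Ioc s t) := by
    rw [hν, withDensity_apply _ measurableSet_Ioc, Measure.restrict_restrict measurableSet_Ioc,
      inter_eq_left.2 (hst'.trans (hsub.trans Ioo_subset_Icc_self))]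
    calc _ = ∫⁻ _ in Ioc s t, ENNReal.ofReal g₀ := by
          simp [ENNReal.ofReal_mul hg₀.le]
      _ ≤ _ := setLIntegral_mono' measurableSet_Ioc fun w hw =>
          ENNReal.ofReal_le_ofReal (hle w (hst' hw))
  exact (ENNReal.ofReal_le_iff_le_toReal (measure_ne_top _ _)).1 h1

theorem HasContinuousDensityOn.measure_Ioi_pos [IsFiniteMeasure ν] (h : HasContinuousDensityOn ν κ B) (hκB : κ < B)
    {q : ℝ} (hq : q < B) : 0 < ν.real (Ioi q) := by
  obtain ⟨u, hu1, hu2⟩ := exists_between (max_lt hκB hq)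
  obtain ⟨v, hv1, hv2⟩ := exists_between hu2
  obtain ⟨g₀, hg₀, hle⟩ := h.exists_lower ((le_max_left _ _).trans_lt hu1) hv2
  refine (mul_pos hg₀ (sub_pos.2 hv1)).trans_le ((hle u v le_rfl hv1.le le_rfl).trans ?_)
  exact measureReal_mono fun w hw => ((le_max_right _ _).trans_lt hu1).trans hw.1

end Density

/-! ### The mean drift and its unique zero. -/

/-- The mean drift `∫_{w > q} (a - w) dν(w)`. -/
noncomputable def drift (ν : Measure ℝ) (a q : ℝ) : ℝ := ∫ w in Ioi q, (a - w) ∂ν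

section Drift

variable {ν : Measure ℝ} [IsProbabilityMeasure ν] {κ B a : ℝ}

theorem integrable_sub_of_ae_mem (hν : ∀ᵐ w ∂ν, w ∈ Icc κ B) :
    Integrable (fun w => a - w) ν := by
  refine Integrable.of_bound (measurable_const.sub measurable_id).aestronglyMeasurable
    (|a - κ| + |a - B|) ?_
  filter_upwards [hν] with w hw
  rw [Real.norm_eq_abs]
  refine abs_le.2 ⟨?_, ?_⟩
  · have := neg_abs_le (a - B); have := abs_nonneg (a - κ); linarith [hw.2]
  · have := le_abs_self (a - κ); have := abs_nonneg (a - B); linarith [hw.1]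

theorem drift_sub_drift (hν : ∀ᵐ w ∂ν, w ∈ Icc κ B) {q q' : ℝ} (hqq : q ≤ q') :
    drift ν a q - drift ν a q' = ∫ w in Ioc q q', (a - w) ∂ν := by
  have hi := integrable_sub_of_ae_mem (a := a) hν
  rw [drift, drift, ← Ioc_union_Ioi_eq_Ioi hqq,
    setIntegral_union (Ioc_disjoint_Ioi le_rfl) measurableSet_Ioi
      hi.integrableOn hi.integrableOn]
  ring

/-- The integrand is at least `a - q'` on the slab `(q, q']`. For `q' < a` this turns a lower bound
on mass into a lower bound on the slope. -/
theorem drift_anti (hν : ∀ᵐ w ∂ν, w ∈ Icc κ B) {q q' : ℝ} (hqq : q ≤ q') :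
    (a - q') * ν.real (Ioc q q') ≤ drift ν a q - drift ν a q' := by
  have hi := integrable_sub_of_ae_mem (a := a) hν
  rw [drift_sub_drift hν hqq]
  calc _ = ∫ _ in Ioc q q', (a - q') ∂ν := by simp [mul_comm]
    _ ≤ _ := setIntegral_mono_on (by simp) hi.integrableOn measurableSet_Ioc
        fun w hw => by linarith [hw.2]

theorem drift_mono (hν : ∀ᵐ w ∂ν, w ∈ Icc κ B) {q q' : ℝ} (hqq : q ≤ q') (hq : a ≤ q) :
    drift ν a q ≤ drift ν a q' := by
  have := drift_sub_drift (a := a) hν hqq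
  have h2 : ∫ w in Ioc q q', (a - w) ∂ν ≤ 0 :=
    setIntegral_nonpos measurableSet_Ioc fun w hw => by linarith [hw.1]
  linarith

/-- The integrand has absolute value at most 1 on the support, and a slab of width `|q - q'|` has
mass at most `M |q - q'|`. -/
theorem abs_drift_sub_le (hν : ∀ᵐ w ∂ν, w ∈ Icc κ B) (hκ : 0 ≤ κ) (hB : B ≤ 1)
    (ha : a ∈ Icc (0 : ℝ) 1) {M : ℝ} (hM : ∀ u v : ℝ, u ≤ v → ν.real (Icc u v) ≤ M * (v - u))
    (q q' : ℝ) : |drift ν a q - drift ν a q'| ≤ M * |q - q'| := by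
  wlog hqq : q ≤ q' generalizing q q'
  · rw [abs_sub_comm, abs_sub_comm q]; exact this _ _ (le_of_not_ge hqq)
  rw [drift_sub_drift hν hqq, abs_sub_comm q, abs_of_nonneg (sub_nonneg.2 hqq)]
  refine le_trans ?_ (hM q q' hqq)
  have h1 : ‖∫ w in Ioc q q', (a - w) ∂ν‖ ≤ 1 * ν.real (Ioc q q') := by
    refine norm_setIntegral_le_of_norm_le_const_ae (measure_lt_top _ _) ?_
    filter_upwards [ae_restrict_of_ae hν] with w hw
    rw [Real.norm_eq_abs]
    exact abs_le.2 ⟨by linarith [hw.2, ha.1], by linarith [hw.1, ha.2]⟩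
  rw [Real.norm_eq_abs, one_mul] at h1
  exact h1.trans (measureReal_mono Ioc_subset_Icc_self)

theorem drift_neg (h : HasContinuousDensityOn ν κ B) (hκB : κ < B) {q : ℝ} (haq : a ≤ q)
    (hq : q < B) : drift ν a q < 0 := by
  -- A point strictly above `q` is needed: at `q = a` the bound `a - q` on the integrand would only
  -- be zero.
  obtain ⟨q', h1, h2⟩ := exists_between hq
  have hi := integrable_sub_of_ae_mem (a := a) h.ae_mem
  have hmono := drift_mono h.ae_mem h1.le haq
  have hle : drift ν a q' ≤ ∫ _ in Ioi q', (a - q') ∂ν :=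
    setIntegral_mono_on hi.integrableOn (by simp) measurableSet_Ioi
      fun w hw => by have := mem_Ioi.1 hw; linarith
  have hpos := h.measure_Ioi_pos hκB h2
  have : ∫ _ in Ioi q', (a - q') ∂ν = ν.real (Ioi q') * (a - q') := by simp
  have := mul_neg_of_pos_of_neg hpos (show a - q' < 0 by linarith)
  linarith

/-- The drift has exactly one zero `q₀` in `(κ, a)`, and it pushes towards `q₀` with at least
linear strength on `(-∞, b]`, for every `b < B`. -/
theorem exists_drift_eq_zero (h : HasContinuousDensityOn ν κ B) (hκ : 0 ≤ κ) (hκB : κ < B)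
    (hB : B ≤ 1) (haB : a < B) (ha : ∫ w, w ∂ν < a) :
    ∃ q₀ ∈ Ioo κ a, drift ν a q₀ = 0 ∧ (∀ q ∈ Ioo κ a, drift ν a q = 0 → q = q₀) ∧
      ∀ b ∈ Ico a B, ∃ r > 0, ∃ m > 0, ∀ η ∈ Ioc 0 r,
        (∀ q ≤ q₀ - η, m * η ≤ drift ν a q) ∧
        ∀ q ∈ Icc (q₀ + η) b, drift ν a q ≤ -(m * η) := by
  have hν := h.ae_mem
  obtain ⟨M, hM0, hM⟩ := h.exists_upper
  have hint : Integrable (fun w : ℝ => w) ν := by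
    refine (integrable_sub_of_ae_mem (a := 0) hν).neg.congr (Eventually.of_forall fun w => ?_)
    simp
  have hκa : κ < a := by
    refine lt_of_le_of_lt ?_ ha
    calc κ = ∫ _, κ ∂ν := by simp
      _ ≤ _ := integral_mono_ae (integrable_const _) hint (by
          filter_upwards [hν] with w hw using hw.1)
  have ha01 : a ∈ Icc (0 : ℝ) 1 := ⟨by linarith, by linarith⟩
  have hlip := abs_drift_sub_le hν hκ hB ha01 hM
  have hcont : Continuous (drift ν a) := by
    refine (LipschitzWith.of_dist_le_mul (K := ⟨M, hM0.le⟩) fun x y => ?_).continuous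
    rw [Real.dist_eq, Real.dist_eq]
    exact hlip x y
  -- There is no atom at `κ`, so the drift there is `a` minus the mean.
  have hGκ : 0 < drift ν a κ := by
    have h1 : ∀ᵐ w ∂ν, w ∈ Ioi κ := by
      have h0 : ν.real (Icc κ κ) = 0 := le_antisymm (by simpa using hM κ κ le_rfl)
        measureReal_nonneg
      rw [Icc_self] at h0
      have h0' : ν {κ} = 0 := (measureReal_eq_zero_iff).1 h0
      filter_upwards [hν, measure_eq_zero_iff_ae_notMem.1 h0'] with w hw hw'
      exact lt_of_le_of_ne hw.1 fun e => hw' (by simp [e])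
    rw [drift, setIntegral_eq_integral_of_ae_compl_eq_zero]
    · rw [integral_sub (integrable_const _) hint]
      simpa using ha
    · filter_upwards [h1] with w hw hw' using absurd hw hw'
  have hGa := drift_neg h hκB le_rfl haB
  obtain ⟨q₀, hq₀, hz⟩ := intermediate_value_Ioo' hκa.le hcont.continuousOn ⟨hGa, hGκ⟩
  have hstrict : ∀ q q', q ∈ Ioo κ a → q' ∈ Ioo κ a → q < q' → drift ν a q' < drift ν a q := by
    intro q q' hq hq' hlt
    obtain ⟨g₀, hg₀, hle⟩ := h.exists_lower hq.1 (hq'.2.trans haB)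
    have h1 := drift_anti (a := a) hν hlt.le
    have h2 := mul_pos (sub_pos.2 hq'.2) ((mul_pos hg₀ (sub_pos.2 hlt)).trans_le
      (hle q q' le_rfl hlt.le le_rfl))
    linarith
  refine ⟨q₀, hq₀, hz, fun q hq hq0 => ?_, fun b hb => ?_⟩
  · rcases lt_trichotomy q q₀ with hlt | heq | hgt
    · have := hstrict q q₀ hq hq₀ hlt; linarith
    · exact heq
    · have := hstrict q₀ q hq₀ hq hgt; linarith
  obtain ⟨u, hu1, hu2⟩ := exists_between hq₀.1
  obtain ⟨v, hv1, hv2⟩ := exists_between hq₀.2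
  obtain ⟨g₀, hg₀, hle⟩ := h.exists_lower hu1 (hv2.trans haB)
  have hGb := drift_neg h hκB hb.1 hb.2
  set r := min (q₀ - u) (v - q₀) with hr
  have hr0 : 0 < r := lt_min (by linarith) (by linarith)
  have hru : r ≤ q₀ - u := min_le_left _ _
  have hrv : r ≤ v - q₀ := min_le_right _ _
  -- The first entry bounds the slope of the drift within `r` of `q₀`. The second handles `q ∈ [a,
  -- b]`, where the drift increases and so is at most `drift ν a b < 0`; dividing by `r` gives `m *
  -- η ≤ -drift ν a b` for every `η ≤ r`.
  set m := min ((a - v) * g₀) (-drift ν a b / r) with hm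
  have hm0 : 0 < m := lt_min (mul_pos (by linarith) hg₀) (div_pos (by linarith) hr0)
  have hslope : ∀ s t, u ≤ s → s ≤ t → t ≤ v → m * (t - s) ≤ drift ν a s - drift ν a t := by
    intro s t hs hst ht
    have h1 := drift_anti (a := a) hν hst
    have h2 := hle s t hs hst ht
    calc m * (t - s) ≤ (a - v) * g₀ * (t - s) :=
          mul_le_mul_of_nonneg_right (min_le_left _ _) (by linarith)
      _ = (a - v) * (g₀ * (t - s)) := by ring
      _ ≤ (a - t) * ν.real (Ioc s t) :=
          mul_le_mul (by linarith) h2 (mul_nonneg hg₀.le (by linarith)) (by linarith)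
      _ ≤ _ := h1
  have hanti : ∀ s t, s ≤ t → t ≤ a → drift ν a t ≤ drift ν a s := fun s t hst ht => by
    have h1 := drift_anti (a := a) hν hst
    have h2 : 0 ≤ (a - t) * ν.real (Ioc s t) := mul_nonneg (by linarith) measureReal_nonneg
    linarith
  refine ⟨r, hr0, m, hm0, fun η hη => ⟨fun q hq => ?_, fun q hq => ?_⟩⟩
  · have h1 := hslope (q₀ - η) q₀ (by linarith [hη.2]) (by linarith [hη.1]) hv1.le
    have h2 := hanti q (q₀ - η) hq (by linarith [hη.1, hq₀.2])
    rw [hz] at h1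
    have e : q₀ - (q₀ - η) = η := by ring
    rw [e] at h1
    linarith
  · rcases le_total q a with hqa | hqa
    · have h1 := hslope q₀ (q₀ + η) (by linarith) (by linarith [hη.1]) (by linarith [hη.2])
      have h2 := hanti (q₀ + η) q hq.1 hqa
      rw [hz] at h1
      have e : q₀ + η - q₀ = η := by ring
      rw [e] at h1
      linarith
    · have h1 := drift_mono hν hq.2 hqa
      have h2 : m * η ≤ (-drift ν a b / r) * r :=
        mul_le_mul (min_le_right _ _) hη.2 hη.1.le (by
          exact div_nonneg (by linarith) hr0.le)
      rw [div_mul_cancel₀ _ hr0.ne'] at h2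
      linarith

end Drift

/-! ### The target equation as a zero of the drift. -/

section TopProb

variable {d K : ℕ} [NeZero K] (P : Measure (Feature d × Fin K)) [IsProbabilityMeasure P]

theorem measurable_topProb_fst : Measurable fun z : Feature d × Fin K => topProb P z.1 :=
  (measurable_topProb P).comp measurable_fst

theorem drift_map_topProb (a q : ℝ) :
    drift (P.map fun z => topProb P z.1) a q
      = ∫ z, ({z : Feature d × Fin K | q < topProb P z.1}).indicator
          (fun z => a - topProb P z.1) z ∂P := by
  rw [drift, setIntegral_map measurableSet_Ioi
    (f := fun w => a - w) (measurable_const.sub measurable_id).aestronglyMeasurable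
    (measurable_topProb_fst P).aemeasurable,
    integral_indicator (measurableSet_lt measurable_const (measurable_topProb_fst P))]
  rfl

/-- The conditional mean is a quotient by the mass of `{W > q}`; clearing this denominator requires
it to be positive. -/
theorem condMeanTop_eq_iff {q a : ℝ}
    (hq : 0 < (P.map fun z => topProb P z.1).real (Ioi q)) :
    condMeanTop P q = a ↔ drift (P.map fun z => topProb P z.1) a q = 0 := by
  have hS : MeasurableSet {z : Feature d × Fin K | q < topProb P z.1} :=
    measurableSet_lt measurable_const (measurable_topProb_fst P)
  have hreal : (P.map fun z => topProb P z.1).real (Ioi q)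
      = P.real {z | q < topProb P z.1} := by
    rw [map_measureReal_apply (measurable_topProb_fst P) measurableSet_Ioi]; rfl
  rw [hreal] at hq
  have hint : Integrable (fun z : Feature d × Fin K => topProb P z.1) P :=
    Integrable.of_bound (measurable_topProb_fst P).aestronglyMeasurable 1
      (Eventually.of_forall fun z => by
        rw [Real.norm_eq_abs, abs_of_nonneg (topProb_nonneg P _)]; exact topProb_le_one P _)
  have h1 : condMeanTop P q
      = (P.real {z | q < topProb P z.1})⁻¹ * ∫ z in {z | q < topProb P z.1}, topProb P z.1 ∂P := by
    rw [condMeanTop, ProbabilityTheory.cond, integral_smul_measure, ENNReal.toReal_inv]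
    rfl
  rw [drift_map_topProb, integral_indicator hS,
    integral_sub (integrable_const _).integrableOn hint.integrableOn, h1]
  have h2 : ∫ _ in {z : Feature d × Fin K | q < topProb P z.1}, a ∂P
      = P.real {z | q < topProb P z.1} * a := by simp
  rw [h2, inv_mul_eq_iff_eq_mul₀ hq.ne', sub_eq_zero, eq_comm]

end TopProb

/-! ### A deterministic bound for noisy paths pushed towards a band. -/

section Path

/-- A sequence that is pushed down by at least `θ` per step whenever it exceeds `η`, up to noise
whose partial sums are at most `D`, ends close to or below `η`. -/
theorem le_of_pushed_down {x u ξ : ℕ → ℝ} {s t : ℕ} (hst : s ≤ t) {η θ D ρ : ℝ}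
    (hx : ∀ k ∈ Ico s t, x (k + 1) = x k + u k + ξ k)
    (hu : ∀ k ∈ Ico s t, η < x k → u k ≤ -θ) (hθ : 0 ≤ θ)
    (hstep : ∀ k ∈ Ico s t, x (k + 1) ≤ x k + ρ) (hρ : 0 ≤ ρ)
    (hD : ∀ i ∈ Icc s t, ∑ k ∈ Finset.Ico i t, ξ k ≤ D)
    (hfar : x s + D ≤ η + θ * (t - s : ℕ)) : x t ≤ η + ρ + D := by
  have hD0 : 0 ≤ D := by simpa using hD t ⟨hst, le_rfl⟩
  -- While the path stays above `η`, every step contributes at least `θ` of descent, up to the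
  -- noise.
  have key : ∀ i ∈ Icc s t, (∀ k ∈ Ico i t, η < x k) → x t ≤ x i - θ * (t - i : ℕ) + D := by
    intro i hi hk
    have h : ∀ j, i ≤ j → j ≤ t →
        x j ≤ x i - θ * (j - i : ℕ) + ∑ k ∈ Finset.Ico i j, ξ k := by
      intro j hij
      induction j, hij using Nat.le_induction with
      | base => simp
      | succ j hij ih =>
        intro hj
        have hm : j ∈ Ico s t := ⟨hi.1.trans hij, hj⟩
        have h1 := ih (by omega)
        have h2 := hu j hm (hk j ⟨hij, hj⟩)
        rw [hx j hm, Finset.sum_Ico_succ_top hij, Nat.succ_sub hij]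
        push_cast
        linarith
    have h1 := h t hi.2 le_rfl
    have h2 := hD i hi
    linarith
  -- Either restart just after the last visit below `η`, or there is no visit and `hfar` says that
  -- the descent from `x s` is long enough. The restart time depends on the path, hence a noise
  -- bound for every starting index.
  by_cases hex : ∃ k ∈ Finset.Ico s t, x k ≤ η
  · have hne : ((Finset.Ico s t).filter fun k => x k ≤ η).Nonempty := by
      obtain ⟨k, hk, hk'⟩ := hex
      exact ⟨k, Finset.mem_filter.2 ⟨hk, hk'⟩⟩
    set k₀ := ((Finset.Ico s t).filter fun k => x k ≤ η).max' hne with hk₀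
    obtain ⟨hmem, hle⟩ := Finset.mem_filter.1 (Finset.max'_mem _ hne)
    rw [← hk₀] at hmem hle
    obtain ⟨h1, h2⟩ := Finset.mem_Ico.1 hmem
    have h3 := key (k₀ + 1) ⟨by omega, h2⟩ fun k hk => by
      by_contra hcon
      have := Finset.le_max' ((Finset.Ico s t).filter fun k => x k ≤ η) k
        (Finset.mem_filter.2 ⟨Finset.mem_Ico.2 ⟨by have := hk.1; omega, hk.2⟩, not_lt.1 hcon⟩)
      have := hk.1
      omega
    have h4 := hstep k₀ ⟨h1, h2⟩
    have h5 : 0 ≤ θ * (t - (k₀ + 1) : ℕ) := mul_nonneg hθ (Nat.cast_nonneg _)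
    linarith
  · push Not at hex
    have h3 := key s ⟨le_rfl, hst⟩ fun k hk => hex k (Finset.mem_Ico.2 hk)
    linarith

/-- The two-sided version of `le_of_pushed_down`. -/
theorem abs_le_of_pushed {x u ξ : ℕ → ℝ} {s t : ℕ} (hst : s ≤ t) {η θ D ρ : ℝ}
    (hx : ∀ k ∈ Ico s t, x (k + 1) = x k + u k + ξ k)
    (hu : ∀ k ∈ Ico s t, η < x k → u k ≤ -θ) (hu' : ∀ k ∈ Ico s t, x k < -η → θ ≤ u k)
    (hθ : 0 ≤ θ) (hstep : ∀ k ∈ Ico s t, |x (k + 1) - x k| ≤ ρ) (hρ : 0 ≤ ρ)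
    (hD : ∀ i ∈ Icc s t, |∑ k ∈ Finset.Ico i t, ξ k| ≤ D)
    (hfar : |x s| + D ≤ η + θ * (t - s : ℕ)) : |x t| ≤ η + ρ + D := by
  have h1 := le_of_pushed_down hst hx hu hθ
    (fun k hk => by have := (abs_le.1 (hstep k hk)).2; linarith) hρ
    (fun i hi => (abs_le.1 (hD i hi)).2) (by have := le_abs_self (x s); linarith)
  have h2 := le_of_pushed_down (x := fun k => -x k) (u := fun k => -u k) (ξ := fun k => -ξ k)
    (η := η) (θ := θ) (D := D) (ρ := ρ) hst
    (fun k hk => by rw [hx k hk]; ring)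
    (fun k hk h => by have := hu' k hk (by linarith); linarith) hθ
    (fun k hk => by have := (abs_le.1 (hstep k hk)).1; linarith) hρ
    (fun i hi => by rw [Finset.sum_neg_distrib]; have := (abs_le.1 (hD i hi)).1; linarith)
    (by have := neg_abs_le (x s); linarith)
  exact abs_le.2 ⟨by linarith, h1⟩

end Path

/-! ### Bias caused by estimated scores. -/

section Bias

variable {d K : ℕ} [NeZero K] (P : Measure (Feature d × Fin K)) [IsProbabilityMeasure P]

/-- `max_y |v(x, y) - P(Y = y | X = x)|`. -/
noncomputable def scoreError (v : Feature d → Fin K → ℝ) (x : Feature d) : ℝ :=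
  maxScore fun y => |v x y - classProb P x y|

/-- The selection rule `1{max v > q}` at a labelled point. -/
noncomputable def selInd (v : Fin K → ℝ) (q : ℝ) : ℝ := open Classical in if q < maxScore v then 1 else 0

/-- The prediction error `1{y ≠ argmax v}`. -/
noncomputable def errInd (v : Fin K → ℝ) (y : Fin K) : ℝ := open Classical in if y ≠ argmaxLabel v then 1 else 0

/-- The probability of selection. -/
noncomputable def selMass (v : Feature d → Fin K → ℝ) (q : ℝ) : ℝ := ∫ z, selInd (v z.1) q ∂P

/-- The probability of making an error on a selected point. -/
noncomputable def errMass (v : Feature d → Fin K → ℝ) (q : ℝ) : ℝ :=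
  ∫ z, selInd (v z.1) q * errInd (v z.1) z.2 ∂P

theorem selInd_mem (v : Fin K → ℝ) (q : ℝ) : selInd v q ∈ Icc (0 : ℝ) 1 := by
  unfold selInd; split_ifs <;> simp

theorem errInd_mem (v : Fin K → ℝ) (y : Fin K) : errInd v y ∈ Icc (0 : ℝ) 1 := by
  unfold errInd; split_ifs <;> simp

theorem measurable_selInd : Measurable fun p : (Fin K → ℝ) × ℝ => selInd p.1 p.2 :=
  Measurable.ite (measurableSet_lt measurable_snd (measurable_maxScore.comp measurable_fst))
    measurable_const measurable_const

theorem measurable_errInd : Measurable fun p : (Fin K → ℝ) × Fin K => errInd p.1 p.2 :=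
  Measurable.ite (measurableSet_eq_fun measurable_snd
    (measurable_argmaxLabel.comp measurable_fst)).compl measurable_const measurable_const

variable {v : Feature d → Fin K → ℝ} (hv : Measurable v)

include hv in
theorem measurable_scoreError : Measurable (scoreError P v) :=
  measurable_maxScore.comp (measurable_pi_lambda _ fun y =>
    (((measurable_pi_apply y).comp hv).sub (measurable_classProb P y)).abs)

theorem scoreError_nonneg (x : Feature d) : 0 ≤ scoreError P v x :=
  maxScore_nonneg fun _ => abs_nonneg _

theorem scoreError_le_one (hv01 : ∀ x y, v x y ∈ Icc (0 : ℝ) 1) (x : Feature d) :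
    scoreError P v x ≤ 1 :=
  maxScore_le fun y => by
    have h1 := classProb_nonneg P x y
    have h2 := classProb_le_one P x y
    have h3 := hv01 x y
    exact abs_le.2 ⟨by linarith [h3.1], by linarith [h3.2]⟩

/-- Selecting with `v` instead of the true probabilities changes the decision only near the
threshold or where `v` is inaccurate. -/
theorem abs_selInd_sub_le (v : Feature d → Fin K → ℝ) (x : Feature d) (q : ℝ) {e : ℝ}
    (he : 0 < e) :
    |selInd (v x) q - selInd (classProb P x) q|
      ≤ (Icc (q - e) (q + e)).indicator 1 (topProb P x) + scoreError P v x / e := by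
  have h0 : 0 ≤ scoreError P v x / e := div_nonneg (scoreError_nonneg P x) he.le
  have h1 : (0 : ℝ) ≤ (Icc (q - e) (q + e)).indicator 1 (topProb P x) :=
    indicator_nonneg (fun _ _ => zero_le_one) _
  have hclose : |maxScore (v x) - topProb P x| ≤ scoreError P v x :=
    abs_maxScore_sub_le (v x) (classProb P x)
  -- If the decisions differ, the threshold separates the two maxima, so `W` is within the score
  -- error of `q`.
  have hfar : (maxScore (v x) ≤ q ∧ q < topProb P x) ∨ (q < maxScore (v x) ∧ topProb P x ≤ q) →
      1 ≤ (Icc (q - e) (q + e)).indicator 1 (topProb P x) + scoreError P v x / e := by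
    intro h
    rcases le_or_gt e (scoreError P v x) with hle | hlt
    · have := (one_le_div he).2 hle
      linarith
    · have h2 := abs_le.1 hclose
      have hmem : topProb P x ∈ Icc (q - e) (q + e) := by
        rcases h with h | h <;> exact ⟨by linarith, by linarith⟩
      rw [indicator_of_mem hmem, Pi.one_apply]
      linarith
  by_cases ha : q < maxScore (v x) <;> by_cases hb : q < topProb P x
  · have hb' : q < maxScore (classProb P x) := hb
    simp only [selInd, ha, hb', if_true, sub_self, abs_zero]; linarith
  · have hb' : ¬ q < maxScore (classProb P x) := hb
    simp only [selInd, ha, hb', if_true, if_false, sub_zero, abs_one]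
    exact hfar (Or.inr ⟨ha, not_lt.1 hb⟩)
  · have hb' : q < maxScore (classProb P x) := hb
    simp only [selInd, ha, hb', if_true, if_false, zero_sub, abs_neg, abs_one]
    exact hfar (Or.inl ⟨not_lt.1 ha, hb⟩)
  · have hb' : ¬ q < maxScore (classProb P x) := hb
    simp only [selInd, ha, hb', if_false, sub_self, abs_zero]; linarith

variable {M : ℝ}
  (hM : ∀ u w : ℝ, u ≤ w → (P.map fun z => topProb P z.1).real (Icc u w) ≤ M * (w - u))

include hv hM in
-- Window width `√ε` balances the two terms: the window has mass at most `2M√ε`, and the other term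
-- integrates to at most `ε / √ε`.
theorem integral_selInd_error_le (hv01 : ∀ x y, v x y ∈ Icc (0 : ℝ) 1) {ε : ℝ} (hε : 0 < ε)
    (hve : ∫ z, scoreError P v z.1 ∂P ≤ ε) (q : ℝ) :
    Integrable (fun z : Feature d × Fin K =>
      (Icc (q - √ε) (q + √ε)).indicator 1 (topProb P z.1) + scoreError P v z.1 / √ε) P ∧
    ∫ z, ((Icc (q - √ε) (q + √ε)).indicator 1 (topProb P z.1) + scoreError P v z.1 / √ε) ∂P
      ≤ (2 * M + 1) * √ε := by
  have hs : 0 < √ε := Real.sqrt_pos.2 hε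
  have hi1 : Integrable (fun z : Feature d × Fin K =>
      (Icc (q - √ε) (q + √ε)).indicator (1 : ℝ → ℝ) (topProb P z.1)) P :=
    Integrable.of_bound (((measurable_const (a := (1 : ℝ))).indicator measurableSet_Icc).comp
      (measurable_topProb_fst P)).aestronglyMeasurable 1 (Eventually.of_forall fun z => by
        refine (norm_indicator_le_norm_self _ _).trans ?_
        simp)
  have hi2 : Integrable (fun z : Feature d × Fin K => scoreError P v z.1) P :=
    Integrable.of_bound ((measurable_scoreError P hv).comp measurable_fst).aestronglyMeasurable 1
      (Eventually.of_forall fun z => by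
        rw [Real.norm_eq_abs, abs_of_nonneg (scoreError_nonneg P _)]
        exact scoreError_le_one P hv01 _)
  refine ⟨hi1.add (hi2.div_const _), ?_⟩
  rw [integral_add hi1 (hi2.div_const _), integral_div]
  have h1 : ∫ z, (Icc (q - √ε) (q + √ε)).indicator (1 : ℝ → ℝ) (topProb P z.1) ∂P
      = (P.map fun z => topProb P z.1).real (Icc (q - √ε) (q + √ε)) := by
    rw [← integral_indicator_one measurableSet_Icc]
    exact (integral_map (measurable_topProb_fst P).aemeasurable
      ((measurable_const (a := (1 : ℝ))).indicator measurableSet_Icc).aestronglyMeasurable).symm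
  have h2 := hM (q - √ε) (q + √ε) (by linarith)
  have h3 : (∫ z, scoreError P v z.1 ∂P) / √ε ≤ √ε := by
    rw [div_le_iff₀ hs, Real.mul_self_sqrt hε.le]; exact hve
  rw [h1]
  nlinarith

include hv in
theorem measurable_selInd_comp (q : ℝ) : Measurable fun x => selInd (v x) q :=
  measurable_selInd.comp (hv.prodMk measurable_const)

theorem measurable_classProb_pi : Measurable (classProb P) :=
  measurable_pi_lambda _ fun y => measurable_classProb P y

theorem selMass_classProb (q : ℝ) :
    selMass P (classProb P) q = (P.map fun z => topProb P z.1).real (Ioi q) := by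
  rw [map_measureReal_apply (measurable_topProb_fst P) measurableSet_Ioi,
    ← integral_indicator_one (measurable_topProb_fst P measurableSet_Ioi)]
  rfl

include hv in
theorem integrable_selInd (q : ℝ) :
    Integrable (fun z : Feature d × Fin K => selInd (v z.1) q) P :=
  Integrable.of_bound ((measurable_selInd_comp hv q).comp measurable_fst).aestronglyMeasurable 1
    (Eventually.of_forall fun z => by
      have h := selInd_mem (v z.1) q
      rw [Real.norm_eq_abs, abs_of_nonneg h.1]; exact h.2)

include hv hM in
theorem abs_selMass_sub_le (hv01 : ∀ x y, v x y ∈ Icc (0 : ℝ) 1) {ε : ℝ} (hε : 0 < ε)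
    (hve : ∫ z, scoreError P v z.1 ∂P ≤ ε) (q : ℝ) :
    |selMass P v q - (P.map fun z => topProb P z.1).real (Ioi q)| ≤ (2 * M + 1) * √ε := by
  obtain ⟨hi, hle⟩ := integral_selInd_error_le P hv hM hv01 hε hve q
  rw [← selMass_classProb, selMass, selMass, ← integral_sub (integrable_selInd P hv q)
    (integrable_selInd P (measurable_classProb_pi P) q)]
  refine (abs_integral_le_integral_abs.trans (integral_mono_of_nonneg
    (Eventually.of_forall fun z => abs_nonneg _) hi (Eventually.of_forall fun z => ?_))).trans hle
  exact abs_selInd_sub_le P v z.1 q (Real.sqrt_pos.2 hε)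

include hv hM in
/-- The mean drift computed with `v` is close to the mean drift for the true probabilities. -/
theorem abs_errMass_sub_le (hv01 : ∀ x y, v x y ∈ Icc (0 : ℝ) 1) {ε : ℝ} (hε : 0 < ε)
    (hε1 : ε ≤ 1) (hve : ∫ z, scoreError P v z.1 ∂P ≤ ε) (q : ℝ) {α : ℝ}
    (hα : α ∈ Icc (0 : ℝ) 1) :
    |errMass P v q - α * selMass P v q - drift (P.map fun z => topProb P z.1) (1 - α) q|
      ≤ (2 * M + 3) * √ε := by
  obtain ⟨hi, hle⟩ := integral_selInd_error_le P hv hM hv01 hε hve q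
  have hsel := measurable_selInd_comp hv q
  have ha : Measurable fun x => argmaxLabel (v x) := measurable_argmaxLabel.comp hv
  have herr : errMass P v q
      = ∫ z, selInd (v z.1) q * (1 - classProb P z.1 (argmaxLabel (v z.1))) ∂P :=
    integral_mul_indicator_ne P ha hsel (C := 1) fun x => by
      have h := selInd_mem (v x) q
      rw [abs_of_nonneg h.1]; exact h.2
  have hcp : Measurable fun x => classProb P x (argmaxLabel (v x)) := by
    have : (fun x => classProb P x (argmaxLabel (v x)))
        = fun x => ∑ y, if argmaxLabel (v x) = y then classProb P x y else 0 := by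
      ext x; simp
    rw [this]
    exact Finset.measurable_sum _ fun y _ =>
      Measurable.ite (ha (MeasurableSet.singleton y)) (measurable_classProb P y) measurable_const
  have hi1 : Integrable (fun z : Feature d × Fin K =>
      selInd (v z.1) q * (1 - classProb P z.1 (argmaxLabel (v z.1)))) P :=
    (integrable_selInd P hv q).mul_bdd
      ((measurable_const.sub hcp).comp measurable_fst).aestronglyMeasurable (c := 1)
      (Eventually.of_forall fun z => by
        have h1 := classProb_nonneg P z.1 (argmaxLabel (v z.1))
        have h2 := classProb_le_one P z.1 (argmaxLabel (v z.1))
        rw [Real.norm_eq_abs]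
        exact abs_le.2 ⟨by linarith, by linarith⟩)
  have hdrift : drift (P.map fun z => topProb P z.1) (1 - α) q
      = ∫ z, selInd (classProb P z.1) q * (1 - α - topProb P z.1) ∂P := by
    rw [drift_map_topProb]
    congr 1 with z
    by_cases h : q < topProb P z.1
    · have h' : q < maxScore (classProb P z.1) := h
      simp [selInd, h, h']
    · have h' : ¬ q < maxScore (classProb P z.1) := h
      simp [selInd, h, h']
  have hi2 : Integrable (fun z : Feature d × Fin K =>
      selInd (classProb P z.1) q * (1 - α - topProb P z.1)) P :=
    (integrable_selInd P (measurable_classProb_pi P) q).mul_bdd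
      (measurable_const.sub (measurable_topProb_fst P)).aestronglyMeasurable (c := 2)
      (Eventually.of_forall fun z => by
        have h1 := topProb_nonneg P z.1
        have h2 := topProb_le_one P z.1
        rw [Real.norm_eq_abs]
        exact abs_le.2 ⟨by linarith [hα.1, hα.2], by linarith [hα.1, hα.2]⟩)
  have hi3 : Integrable (fun z : Feature d × Fin K => scoreError P v z.1) P :=
    Integrable.of_bound ((measurable_scoreError P hv).comp measurable_fst).aestronglyMeasurable 1
      (Eventually.of_forall fun z => by
        rw [Real.norm_eq_abs, abs_of_nonneg (scoreError_nonneg P _)]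
        exact scoreError_le_one P hv01 _)
  have hi4 := (integrable_selInd P hv q).const_mul α
  -- This absorbs the contribution `2ε` of suboptimal labels into the `√ε` rate.
  have hε' : ε ≤ √ε := by
    have h1 := Real.sqrt_le_one.2 hε1
    nlinarith [Real.mul_self_sqrt hε.le, Real.sqrt_nonneg ε]
  calc |errMass P v q - α * selMass P v q - drift (P.map fun z => topProb P z.1) (1 - α) q|
      = |∫ z, (selInd (v z.1) q * (1 - classProb P z.1 (argmaxLabel (v z.1)))
          - α * selInd (v z.1) q - selInd (classProb P z.1) q * (1 - α - topProb P z.1)) ∂P| := by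
        have e := integral_sub (hi1.sub hi4) hi2
        simp only [Pi.sub_apply] at e
        rw [e, integral_sub hi1 hi4, integral_const_mul, herr, hdrift, selMass]
    _ ≤ ∫ z, (2 * scoreError P v z.1 + ((Icc (q - √ε) (q + √ε)).indicator 1 (topProb P z.1)
          + scoreError P v z.1 / √ε)) ∂P := by
        refine abs_integral_le_integral_abs.trans (integral_mono_of_nonneg
          (Eventually.of_forall fun z => abs_nonneg _) ((hi3.const_mul 2).add hi)
          (Eventually.of_forall fun z => ?_))
        simp only
        have h1 := abs_selInd_sub_le P v z.1 q (Real.sqrt_pos.2 hε)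
        have h2 : topProb P z.1 - classProb P z.1 (argmaxLabel (v z.1))
            ≤ 2 * scoreError P v z.1 := maxScore_sub_argmaxLabel_le (v z.1) (classProb P z.1)
        have h3 : classProb P z.1 (argmaxLabel (v z.1)) ≤ topProb P z.1 := le_maxScore _ _
        have h4 := selInd_mem (v z.1) q
        have h5 := topProb_nonneg P z.1
        have h6 := topProb_le_one P z.1
        -- The first summand is the regret of the predicted label, the second the effect of
        -- selecting differently.
        have e : selInd (v z.1) q * (1 - classProb P z.1 (argmaxLabel (v z.1)))
            - α * selInd (v z.1) q - selInd (classProb P z.1) q * (1 - α - topProb P z.1)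
            = selInd (v z.1) q * (topProb P z.1 - classProb P z.1 (argmaxLabel (v z.1)))
              + (selInd (v z.1) q - selInd (classProb P z.1) q) * (1 - α - topProb P z.1) := by
          ring
        rw [e]
        refine (abs_add_le _ _).trans (add_le_add ?_ ?_)
        · rw [abs_mul, abs_of_nonneg h4.1, abs_of_nonneg (by linarith)]
          exact (mul_le_of_le_one_left (by linarith) h4.2).trans h2
        · rw [abs_mul]
          refine (mul_le_of_le_one_right (abs_nonneg _) ?_).trans h1
          exact abs_le.2 ⟨by linarith [hα.2], by linarith [hα.1]⟩
    _ ≤ (2 * M + 3) * √ε := by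
        rw [integral_add (hi3.const_mul 2) hi, integral_const_mul]
        linarith

end Bias

/-! ### Mean increments of the threshold. -/

section Increment

variable {d K : ℕ} [NeZero K]

/-- The increment of the threshold, divided by the step size. -/
noncomputable def increment (α : ℝ) (v : Fin K → ℝ) (y : Fin K) (q : ℝ) : ℝ :=
  open Classical in selInd v q * ((if q < 0 then 1 else errInd v y) - α)

theorem abs_increment_le {α : ℝ} (hα : α ∈ Icc (0 : ℝ) 1) (v : Fin K → ℝ) (y : Fin K) (q : ℝ) :
    |increment α v y q| ≤ 1 := by
  have h1 := selInd_mem v q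
  have h2 := errInd_mem v y
  rw [increment, abs_mul, abs_of_nonneg h1.1]
  refine mul_le_one₀ h1.2 (abs_nonneg _) ?_
  split_ifs
  · exact abs_le.2 ⟨by linarith [hα.2], by linarith [hα.1]⟩
  · exact abs_le.2 ⟨by linarith [hα.2, h2.1], by linarith [hα.1, h2.2]⟩

variable (P : Measure (Feature d × Fin K)) [IsProbabilityMeasure P]

/-- The mean increment at the threshold `q` when the scores are `v`. -/
noncomputable def incrementMass (α : ℝ) (v : Feature d → Fin K → ℝ) (q : ℝ) : ℝ :=
  ∫ z, increment α (v z.1) z.2 q ∂P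

theorem abs_incrementMass_le {α : ℝ} (hα : α ∈ Icc (0 : ℝ) 1) (v : Feature d → Fin K → ℝ)
    (q : ℝ) : |incrementMass P α v q| ≤ 1 := by
  simpa [incrementMass] using norm_integral_le_of_norm_le_const (μ := P)
    (f := fun z => increment α (v z.1) z.2 q)
    (Eventually.of_forall fun z => abs_increment_le hα (v z.1) z.2 q)

/-- Scores are nonnegative, so a negative threshold selects every point and the update is always
upwards. -/
theorem incrementMass_of_neg {α : ℝ} {v : Feature d → Fin K → ℝ} (hv : ∀ x y, 0 ≤ v x y) {q : ℝ}
    (hq : q < 0) : incrementMass P α v q = 1 - α := by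
  have : ∀ z : Feature d × Fin K, increment α (v z.1) z.2 q = 1 - α := fun z => by
    simp [increment, selInd, hq, hq.trans_le (maxScore_nonneg (hv z.1))]
  simp [incrementMass, this]

theorem incrementMass_of_nonneg {α : ℝ} {v : Feature d → Fin K → ℝ} (hv : Measurable v) {q : ℝ}
    (hq : 0 ≤ q) : incrementMass P α v q = errMass P v q - α * selMass P v q := by
  have hi := integrable_selInd P hv q
  have hi' : Integrable (fun z : Feature d × Fin K => selInd (v z.1) q * errInd (v z.1) z.2) P :=
    hi.mul_bdd (measurable_errInd.comp ((hv.comp measurable_fst).prodMk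
      measurable_snd)).aestronglyMeasurable (c := 1) (Eventually.of_forall fun z => by
        have h := errInd_mem (v z.1) z.2
        rw [Real.norm_eq_abs, abs_of_nonneg h.1]
        exact h.2)
  rw [errMass, selMass, ← integral_const_mul, ← integral_sub hi' (hi.const_mul α), incrementMass]
  congr 1 with z
  rw [increment, if_neg (not_lt.2 hq)]
  ring

end Increment

/-! ### Joint measurability in the past and the current observation. -/

section Joint

variable {Ω : Type*} {m : MeasurableSpace Ω} {d K : ℕ} [NeZero K]
  {E : Ω → Feature d → Fin K → ℝ} (hE : Measurable fun p : Ω × Feature d => E p.1 p.2)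
  {Q : Ω → ℝ} (hQ : Measurable Q)

omit [NeZero K] in
include hE in
theorem measurable_score_joint :
    Measurable fun p : Ω × (Feature d × Fin K) => E p.1 p.2.1 :=
  hE.comp (measurable_fst.prodMk (measurable_fst.comp measurable_snd))

omit [NeZero K] in
include hE in
theorem measurable_score_apply (ω : Ω) : Measurable (E ω) :=
  hE.comp (measurable_const.prodMk measurable_id)

include hE hQ in
theorem measurable_selInd_joint :
    Measurable fun p : Ω × (Feature d × Fin K) => selInd (E p.1 p.2.1) (Q p.1) :=
  measurable_selInd.comp ((measurable_score_joint hE).prodMk (hQ.comp measurable_fst))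

include hE in
theorem measurable_errInd_joint :
    Measurable fun p : Ω × (Feature d × Fin K) => errInd (E p.1 p.2.1) p.2.2 :=
  measurable_errInd.comp ((measurable_score_joint hE).prodMk (measurable_snd.comp measurable_snd))

include hE hQ in
theorem measurable_increment_joint (α : ℝ) :
    Measurable fun p : Ω × (Feature d × Fin K) => increment α (E p.1 p.2.1) p.2.2 (Q p.1) :=
  (measurable_selInd_joint hE hQ).mul ((Measurable.ite
    (measurableSet_lt (hQ.comp measurable_fst) measurable_const) measurable_const
    (measurable_errInd_joint hE)).sub_const α)

include hE in
theorem measurable_scoreError_joint (P : Measure (Feature d × Fin K)) [IsProbabilityMeasure P] :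
    Measurable fun p : Ω × (Feature d × Fin K) => scoreError P (E p.1) p.2.1 :=
  measurable_maxScore.comp (measurable_pi_lambda _ fun y =>
    (((measurable_pi_apply y).comp (measurable_score_joint hE)).sub
      ((measurable_classProb P y).comp (measurable_fst.comp measurable_snd))).abs)

end Joint

theorem measurable_integral_prod_right {Ω Z : Type*} {_ : MeasurableSpace Ω} [MeasurableSpace Z]
    {P : Measure Z} [SFinite P] {f : Ω × Z → ℝ} (hf : Measurable f) :
    Measurable fun ω => ∫ z, f (ω, z) ∂P :=
  hf.stronglyMeasurable.integral_prod_right'.measurable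

/-! ### The recursion for threshold and counter. -/

section Recursion

theorem sciStep_fst {K : ℕ} [NeZero K] (α : ℝ) (γ : ℕ → ℝ) (v : Fin K → ℝ) (y : Fin K)
    (s : ℝ × ℕ) : (sciStep α γ v y s).1 = s.1 + γ s.2 * increment α v y s.1 := by
  by_cases h1 : s.1 < maxScore v
  · by_cases h2 : s.1 < 0
    · simp [sciStep, increment, selInd, h1, h2]
    · by_cases h3 : y = argmaxLabel v <;> simp [sciStep, increment, selInd, errInd, h1, h2, h3]
  · simp [sciStep, increment, selInd, h1]

theorem sciStep_snd {K : ℕ} [NeZero K] (α : ℝ) (γ : ℕ → ℝ) (v : Fin K → ℝ) (y : Fin K)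
    (s : ℝ × ℕ) : ((sciStep α γ v y s).2 : ℝ) = s.2 + selInd v s.1 := by
  by_cases h1 : s.1 < maxScore v <;> simp [sciStep, selInd, h1]

variable {Ω : Type*} {d K : ℕ} [NeZero K] {α : ℝ} {γ : ℕ → ℝ} {q₁ : ℝ}
  {est : ℕ → Ω → Feature d → Fin K → ℝ} {X : ℕ → Ω → Feature d} {Y : ℕ → Ω → Fin K}

/-- The counter `J(t)`. -/
noncomputable def counter (α : ℝ) (γ : ℕ → ℝ) (q₁ : ℝ) (est : ℕ → Ω → Feature d → Fin K → ℝ)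
    (X : ℕ → Ω → Feature d) (Y : ℕ → Ω → Fin K) (t : ℕ) (ω : Ω) : ℕ :=
  (sciState α γ q₁ est X Y t ω).2

local notation "thr" => threshold α γ q₁ est X Y
local notation "cnt" => counter α γ q₁ est X Y

theorem sciState_succ {t : ℕ} (ht : 1 ≤ t) (ω : Ω) :
    sciState α γ q₁ est X Y (t + 1) ω
      = sciStep α γ (est t ω (X t ω)) (Y t ω) (sciState α γ q₁ est X Y t ω) := by
  obtain ⟨s, rfl⟩ : ∃ s, t = s + 1 := ⟨t - 1, by omega⟩
  rfl

theorem threshold_succ {t : ℕ} (ht : 1 ≤ t) (ω : Ω) :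
    thr (t + 1) ω = thr t ω
      + γ (cnt t ω) * increment α (est t ω (X t ω)) (Y t ω) (thr t ω) := by
  rw [threshold, sciState_succ ht, sciStep_fst]
  rfl

theorem counter_succ {t : ℕ} (ht : 1 ≤ t) (ω : Ω) :
    (cnt (t + 1) ω : ℝ) = cnt t ω + selInd (est t ω (X t ω)) (thr t ω) := by
  rw [counter, sciState_succ ht, sciStep_snd]
  rfl

theorem counter_le_succ {t : ℕ} (ht : 1 ≤ t) (ω : Ω) : cnt t ω ≤ cnt (t + 1) ω := by
  have h : (cnt t ω : ℝ) ≤ cnt (t + 1) ω := by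
    rw [counter_succ ht]
    linarith [(selInd_mem (est t ω (X t ω)) (thr t ω)).1]
  exact_mod_cast h

theorem counter_mono {s t : ℕ} (hs : 1 ≤ s) (hst : s ≤ t) (ω : Ω) : cnt s ω ≤ cnt t ω := by
  induction t, hst using Nat.le_induction with
  | base => exact le_rfl
  | succ t hst ih => exact ih.trans (counter_le_succ (hs.trans hst) ω)

theorem one_le_counter {t : ℕ} (ht : 1 ≤ t) (ω : Ω) : 1 ≤ cnt t ω :=
  counter_mono le_rfl ht ω

theorem counter_le {t : ℕ} (ht : 1 ≤ t) (ω : Ω) : cnt t ω ≤ t := by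
  induction t, ht using Nat.le_induction with
  | base => exact le_rfl
  | succ t ht ih =>
    have h : (cnt (t + 1) ω : ℝ) ≤ ((t + 1 : ℕ) : ℝ) := by
      rw [counter_succ ht]
      have := (selInd_mem (est t ω (X t ω)) (thr t ω)).2
      have : (cnt t ω : ℝ) ≤ t := by exact_mod_cast ih
      push_cast
      linarith
    exact_mod_cast h

/-- A move requires `q < max v ≤ 1`, so one step cannot exceed `1 + c`; below `0` all moves go up,
so one step down from `[0, 1)` reaches at worst `-c`. Hence the path argument may start at any
round, whatever happened before. -/
theorem threshold_mem {c : ℝ} (hα : α ∈ Icc (0 : ℝ) 1) (hγ : ∀ j, 1 ≤ j → γ j ∈ Icc 0 c)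
    (hq₁ : q₁ ∈ Icc (0 : ℝ) (1 - α)) (hest : ∀ t, 1 ≤ t → ∀ ω x y, est t ω x y ∈ Icc (0 : ℝ) 1)
    {t : ℕ} (ht : 1 ≤ t) (ω : Ω) : thr t ω ∈ Icc (-c) (1 + c) := by
  have hc : 0 ≤ c := (hγ 1 le_rfl).1.trans (hγ 1 le_rfl).2
  induction t, ht using Nat.le_induction with
  | base => exact ⟨by linarith [hq₁.1, show thr 1 ω = q₁ from rfl],
      by linarith [hq₁.2, hα.1, show thr 1 ω = q₁ from rfl]⟩
  | succ t ht ih =>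
    rw [threshold_succ ht]
    have hg := hγ _ (one_le_counter (α := α) (γ := γ) (q₁ := q₁) (est := est) (X := X) (Y := Y)
      ht ω)
    have h2 := errInd_mem (est t ω (X t ω)) (Y t ω)
    set g := γ (cnt t ω)
    set q := thr t ω
    by_cases hsel : q < maxScore (est t ω (X t ω))
    · have hq1 : q < 1 := hsel.trans_le (maxScore_le fun y => (hest t ht ω _ y).2)
      have habs := abs_le.1 (abs_increment_le hα (est t ω (X t ω)) (Y t ω) q)
      refine ⟨?_, by nlinarith [hg.1, hg.2]⟩
      rcases lt_or_ge q 0 with hq0 | hq0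
      · have : increment α (est t ω (X t ω)) (Y t ω) q = 1 - α := by
          simp [increment, selInd, hsel, hq0]
        rw [this]
        have := mul_nonneg hg.1 (sub_nonneg.2 hα.2)
        linarith [ih.1]
      · nlinarith [hg.1, hg.2]
    · have : increment α (est t ω (X t ω)) (Y t ω) q = 0 := by simp [increment, selInd, hsel]
      rw [this, mul_zero, add_zero]
      exact ih

end Recursion

/-! ### Martingale noise and conditional expectations in the model. -/

/-- The deviation of the selection at round `t` from its conditional mean. -/
noncomputable def selNoise {Ω : Type*} {d K : ℕ} [NeZero K]
    (P : Measure (Feature d × Fin K)) (α : ℝ) (γ : ℕ → ℝ) (q₁ : ℝ)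
    (est : ℕ → Ω → Feature d → Fin K → ℝ) (X : ℕ → Ω → Feature d) (Y : ℕ → Ω → Fin K)
    (t : ℕ) (ω : Ω) : ℝ :=
  selInd (est t ω (X t ω)) (threshold α γ q₁ est X Y t ω)
    - selMass P (est t ω) (threshold α γ q₁ est X Y t ω)

/-- The deviation of the threshold update at round `t` from its conditional mean, on the event
that at least `j` points have been selected. -/
noncomputable def stepNoise {Ω : Type*} {d K : ℕ} [NeZero K]
    (P : Measure (Feature d × Fin K)) (α : ℝ) (γ : ℕ → ℝ) (q₁ : ℝ)
    (est : ℕ → Ω → Feature d → Fin K → ℝ) (X : ℕ → Ω → Feature d) (Y : ℕ → Ω → Fin K)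
    (j t : ℕ) (ω : Ω) : ℝ :=
  (if j ≤ counter α γ q₁ est X Y t ω then γ (counter α γ q₁ est X Y t ω) else 0) *
    (increment α (est t ω (X t ω)) (Y t ω) (threshold α γ q₁ est X Y t ω)
      - incrementMass P α (est t ω) (threshold α γ q₁ est X Y t ω))

/-- The iid classification model with an independent holdout sample, together with estimators
with values in `[0, 1]` that only depend on the past. -/
structure IsModel {Ω : Type*} [MeasurableSpace Ω] (μ : Measure Ω) {d K n : ℕ} [NeZero K]
    (P : Measure (Feature d × Fin K)) (X : ℕ → Ω → Feature d) (Y : ℕ → Ω → Fin K)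
    (D0 : Ω → Fin n → Feature d × Fin K) (est : ℕ → Ω → Feature d → Fin K → ℝ) : Prop where
  measurable_X : ∀ t, 1 ≤ t → Measurable (X t)
  measurable_Y : ∀ t, 1 ≤ t → Measurable (Y t)
  measurable_D0 : Measurable D0
  law : ∀ t, 1 ≤ t → μ.map (fun ω => (X t ω, Y t ω)) = P
  indep : iIndepFun (fun (t : ℕ) ω => (X (t + 1) ω, Y (t + 1) ω)) μ
  indepD0 : IndepFun D0 (fun ω (t : ℕ) => (X (t + 1) ω, Y (t + 1) ω)) μ
  range : ∀ t, 1 ≤ t → ∀ ω x y, est t ω x y ∈ Icc (0 : ℝ) 1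
  measurable_est : ∀ t, 1 ≤ t →
    Measurable[(history D0 X Y (t - 1)).prod inferInstance]
      (fun p : Ω × Feature d => est t p.1 p.2)

namespace IsModel

variable {Ω : Type*} {m0 : MeasurableSpace Ω} {μ : Measure Ω} {d K n : ℕ} [NeZero K]
  {P : Measure (Feature d × Fin K)} {X : ℕ → Ω → Feature d} {Y : ℕ → Ω → Fin K}
  {D0 : Ω → Fin n → Feature d × Fin K} {est : ℕ → Ω → Feature d → Fin K → ℝ}
  (h : IsModel μ P X Y D0 est) {α : ℝ} {γ : ℕ → ℝ} {q₁ : ℝ}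

local notation "thr" => threshold α γ q₁ est X Y
local notation "cnt" => counter α γ q₁ est X Y

include h in
theorem history_le (t : ℕ) : history D0 X Y t ≤ m0 :=
  OnlineSCI.history_le h.measurable_X h.measurable_Y h.measurable_D0 t

omit [NeZero K] in
theorem measurable_id_prodMk {t : ℕ} (ht : 1 ≤ t) :
    @Measurable Ω (Ω × (Feature d × Fin K)) (history D0 X Y t)
      ((history D0 X Y (t - 1)).prod inferInstance) fun ω => (ω, (X t ω, Y t ω)) :=
  @Measurable.prodMk _ (history D0 X Y t) _ _ (history D0 X Y (t - 1)) _ _ _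
    (measurable_id'' (history_mono (Nat.sub_le t 1))) (measurable_pair_history ht)

include h in
theorem condExp_eq [IsProbabilityMeasure μ] [IsProbabilityMeasure P] {t : ℕ} (ht : 1 ≤ t)
    {f : Ω × (Feature d × Fin K) → ℝ}
    (hf : Measurable[(history D0 X Y (t - 1)).prod inferInstance] f) {C : ℝ}
    (hC : ∀ p, |f p| ≤ C) :
    μ[fun ω => f (ω, (X t ω, Y t ω)) | history D0 X Y (t - 1)]
      =ᵐ[μ] fun ω => ∫ z, f (ω, z) ∂P :=
  condExp_indep_prod (h.history_le (t - 1))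
    ((h.measurable_X t ht).prodMk (h.measurable_Y t ht))
    (indep_history h.measurable_X h.measurable_Y h.measurable_D0 h.indep h.indepD0 ht)
    (h.law t ht) hf hC

include h in
theorem measurable_state {t : ℕ} (ht : 1 ≤ t) :
    Measurable[history D0 X Y (t - 1)] (thr t) ∧ Measurable[history D0 X Y (t - 1)] (cnt t) := by
  induction t, ht using Nat.le_induction with
  | base => exact ⟨measurable_const, measurable_const⟩
  | succ t ht ih =>
    rw [Nat.add_sub_cancel]
    have hmono : history D0 X Y (t - 1) ≤ history D0 X Y t := history_mono (Nat.sub_le t 1)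
    have hq : Measurable[history D0 X Y t] (thr t) := ih.1.mono hmono le_rfl
    have hJ : Measurable[history D0 X Y t] (cnt t) := ih.2.mono hmono le_rfl
    have hpair := measurable_id_prodMk (D0 := D0) (X := X) (Y := Y) ht
    have hinc : Measurable[history D0 X Y t] fun ω =>
        increment α (est t ω (X t ω)) (Y t ω) (thr t ω) :=
      (measurable_increment_joint (h.measurable_est t ht) ih.1 α).comp hpair
    have hsel : Measurable[history D0 X Y t] fun ω => selInd (est t ω (X t ω)) (thr t ω) :=
      (measurable_selInd_joint (h.measurable_est t ht) ih.1).comp hpair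
    have hγ : Measurable[history D0 X Y t] fun ω => γ (cnt t ω) :=
      (measurable_of_countable γ).comp hJ
    constructor
    · have e : thr (t + 1) = fun ω => thr t ω
          + γ (cnt t ω) * increment α (est t ω (X t ω)) (Y t ω) (thr t ω) :=
        funext fun ω => threshold_succ ht ω
      rw [e]
      exact hq.add (hγ.mul hinc)
    -- The recursion for the counter holds after casting to `ℝ`; the floor recovers the integer.
    · have e : cnt (t + 1) = fun ω => ⌊(cnt t ω : ℝ) + selInd (est t ω (X t ω)) (thr t ω)⌋₊ :=
        funext fun ω => by rw [← counter_succ ht, Nat.floor_natCast]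
      rw [e]
      exact Nat.measurable_floor.comp (((measurable_of_countable _).comp hJ).add hsel)

variable [IsProbabilityMeasure μ] [IsProbabilityMeasure P]

include h in
theorem condExp_selInd {t : ℕ} (ht : 1 ≤ t) :
    μ[fun ω => selInd (est t ω (X t ω)) (thr t ω) | history D0 X Y (t - 1)]
      =ᵐ[μ] fun ω => selMass P (est t ω) (thr t ω) :=
  h.condExp_eq ht (C := 1)
    (measurable_selInd_joint (h.measurable_est t ht) (h.measurable_state ht).1) fun p => by
      have := selInd_mem (est t p.1 p.2.1) (thr t p.1)
      rw [abs_of_nonneg this.1]; exact this.2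

include h in
theorem condExp_errInd {t : ℕ} (ht : 1 ≤ t) :
    μ[fun ω => selInd (est t ω (X t ω)) (thr t ω) * errInd (est t ω (X t ω)) (Y t ω) |
      history D0 X Y (t - 1)] =ᵐ[μ] fun ω => errMass P (est t ω) (thr t ω) := by
  refine h.condExp_eq ht (C := 1)
    (f := fun p => selInd (est t p.1 p.2.1) (thr t p.1) * errInd (est t p.1 p.2.1) p.2.2)
    (Measurable.mul (measurable_selInd_joint (h.measurable_est t ht) (h.measurable_state ht).1)
      (measurable_errInd_joint (h.measurable_est t ht))) fun p => ?_
  have h1 := selInd_mem (est t p.1 p.2.1) (thr t p.1)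
  have h2 := errInd_mem (est t p.1 p.2.1) p.2.2
  rw [abs_of_nonneg (mul_nonneg h1.1 h2.1)]
  exact mul_le_one₀ h1.2 h2.1 h2.2

include h in
-- The current pair is independent of the past, so numerator and denominator are integrals over `P`.
-- The equality is only almost sure, which costs a null event later.
theorem instErrorRate_ae_eq {t : ℕ} (ht : 1 ≤ t) :
    instErrorRate μ D0 est X Y thr t
      =ᵐ[μ] fun ω => errMass P (est t ω) (thr t ω) / selMass P (est t ω) (thr t ω) := by
  have e1 : (selectedEvent est X thr t).indicator (fun _ => (1 : ℝ))
      = fun ω => selInd (est t ω (X t ω)) (thr t ω) := by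
    ext ω
    by_cases hs : thr t ω < maxScore (est t ω (X t ω)) <;>
      simp [indicator, selectedEvent, selInd, hs]
  have e2 : (errorEvent est X Y t ∩ selectedEvent est X thr t).indicator (fun _ => (1 : ℝ))
      = fun ω => selInd (est t ω (X t ω)) (thr t ω) * errInd (est t ω (X t ω)) (Y t ω) := by
    ext ω
    by_cases hs : thr t ω < maxScore (est t ω (X t ω)) <;>
    by_cases hy : Y t ω = argmaxLabel (est t ω (X t ω)) <;>
      simp [indicator, selectedEvent, errorEvent, selInd, errInd, hs, hy]
  filter_upwards [h.condExp_selInd (α := α) (γ := γ) (q₁ := q₁) ht,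
    h.condExp_errInd (α := α) (γ := γ) (q₁ := q₁) ht] with ω h1 h2
  rw [instErrorRate, condProbGiven, e1, e2, h1, h2]

include h in
theorem condExp_scoreError {t : ℕ} (ht : 1 ≤ t) :
    μ[fun ω => scoreError P (est t ω) (X t ω) | history D0 X Y (t - 1)]
      =ᵐ[μ] fun ω => ∫ z, scoreError P (est t ω) z.1 ∂P :=
  h.condExp_eq ht (C := 1) (f := fun p => scoreError P (est t p.1) p.2.1)
    (measurable_scoreError_joint (h.measurable_est t ht) P) fun p => by
      rw [abs_of_nonneg (scoreError_nonneg P _)]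
      exact scoreError_le_one P (h.range t ht p.1) _

theorem selMass_mem (P : Measure (Feature d × Fin K)) [IsProbabilityMeasure P]
    (v : Feature d → Fin K → ℝ) (q : ℝ) : selMass P v q ∈ Icc (0 : ℝ) 1 := by
  refine ⟨integral_nonneg fun z => (selInd_mem _ _).1, ?_⟩
  have := norm_integral_le_of_norm_le_const (μ := P) (C := 1) (f := fun z => selInd (v z.1) q)
    (Eventually.of_forall fun z => by
      have := selInd_mem (v z.1) q
      rw [Real.norm_eq_abs, abs_of_nonneg this.1]; exact this.2)
  rw [probReal_univ, mul_one] at this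
  exact (le_abs_self _).trans this

include h in
/-- A martingale difference is obtained from a jointly measurable function by subtracting its
integral. -/
theorem centred {t : ℕ} (ht : 1 ≤ t) {f : Ω × (Feature d × Fin K) → ℝ}
    (hf : Measurable[(history D0 X Y (t - 1)).prod inferInstance] f) {C : ℝ}
    (hC : ∀ p, |f p| ≤ C) {a : Ω → ℝ} (ha : Measurable[history D0 X Y (t - 1)] a) {A : ℝ}
    (hA : ∀ ω, |a ω| ≤ A) :
    Measurable[history D0 X Y t]
        (fun ω => a ω * (f (ω, (X t ω, Y t ω)) - ∫ z, f (ω, z) ∂P)) ∧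
      μ[fun ω => a ω * (f (ω, (X t ω, Y t ω)) - ∫ z, f (ω, z) ∂P) | history D0 X Y (t - 1)]
        =ᵐ[μ] 0 := by
  have hint : Measurable[history D0 X Y (t - 1)] fun ω => ∫ z, f (ω, z) ∂P :=
    measurable_integral_prod_right hf
  have hIC : ∀ ω, |∫ z, f (ω, z) ∂P| ≤ C := fun ω => by
    simpa using norm_integral_le_of_norm_le_const (μ := P) (f := fun z => f (ω, z))
      (Eventually.of_forall fun z => hC (ω, z))
  have hF : Measurable[(history D0 X Y (t - 1)).prod inferInstance]
      fun p : Ω × (Feature d × Fin K) => a p.1 * (f p - ∫ z, f (p.1, z) ∂P) :=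
    (ha.comp (@measurable_fst _ _ (history D0 X Y (t - 1)) _)).mul
      (hf.sub (hint.comp (@measurable_fst _ _ (history D0 X Y (t - 1)) _)))
  refine ⟨hF.comp (measurable_id_prodMk ht), ?_⟩
  have hb : ∀ p : Ω × (Feature d × Fin K), |a p.1 * (f p - ∫ z, f (p.1, z) ∂P)| ≤ A * (C + C) :=
    fun p => by
      rw [abs_mul]
      refine mul_le_mul (hA _) ((abs_sub _ _).trans (add_le_add (hC p) (hIC p.1))) (abs_nonneg _)
        ((abs_nonneg _).trans (hA p.1))
  filter_upwards [h.condExp_eq ht hF hb] with ω hω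
  rw [hω]
  have hi : Integrable (fun z => f (ω, z)) P :=
    Integrable.of_bound (Measurable.aestronglyMeasurable
      (hf.comp (@measurable_prodMk_left _ _ (history D0 X Y (t - 1)) _ ω))) C
      (Eventually.of_forall fun z => hC (ω, z))
  simp [integral_const_mul, integral_sub hi (integrable_const _)]

include h in
theorem selNoise_spec {t : ℕ} (ht : 1 ≤ t) :
    Measurable[history D0 X Y t] (selNoise P α γ q₁ est X Y t) ∧
      (∀ ω, |selNoise P α γ q₁ est X Y t ω| ≤ 1) ∧
      μ[selNoise P α γ q₁ est X Y t | history D0 X Y (t - 1)] =ᵐ[μ] 0 := by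
  have hc := h.centred ht (C := 1)
    (measurable_selInd_joint (h.measurable_est t ht) (h.measurable_state (α := α) (γ := γ)
      (q₁ := q₁) ht).1) (fun p => by
      have := selInd_mem (est t p.1 p.2.1) (thr t p.1)
      rw [abs_of_nonneg this.1]; exact this.2)
    (a := fun _ => 1) measurable_const (A := 1) (by simp)
  simp only [one_mul] at hc
  refine ⟨hc.1, fun ω => ?_, hc.2⟩
  have h1 := selInd_mem (est t ω (X t ω)) (thr t ω)
  have h2 := selMass_mem P (est t ω) (thr t ω)
  rw [selNoise]
  exact abs_le.2 ⟨by linarith [h1.1, h2.2], by linarith [h1.2, h2.1]⟩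

include h in
-- The gate `j ≤ cnt t` is known before round `t` and enforces a deterministic bound on the step
-- size, as Azuma-Hoeffding requires, although the counter is random.
theorem stepNoise_spec (hα : α ∈ Icc (0 : ℝ) 1) {j : ℕ} {c : ℝ} (hc : 0 ≤ c)
    (hγ : ∀ i, j ≤ i → |γ i| ≤ c) {t : ℕ} (ht : 1 ≤ t) :
    Measurable[history D0 X Y t] (stepNoise P α γ q₁ est X Y j t) ∧
      (∀ ω, |stepNoise P α γ q₁ est X Y j t ω| ≤ c * 2) ∧
      μ[stepNoise P α γ q₁ est X Y j t | history D0 X Y (t - 1)] =ᵐ[μ] 0 := by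
  obtain ⟨hq, hJ⟩ := h.measurable_state (α := α) (γ := γ) (q₁ := q₁) ht
  have hb : ∀ ω, |if j ≤ cnt t ω then γ (cnt t ω) else 0| ≤ c := fun ω => by
    split_ifs with hj
    · exact hγ _ hj
    · simpa using hc
  have hc := h.centred ht (C := 1) (measurable_increment_joint (h.measurable_est t ht) hq α)
    (fun p => abs_increment_le hα _ _ _)
    (a := fun ω => if j ≤ cnt t ω then γ (cnt t ω) else 0)
    ((measurable_of_countable fun i => if j ≤ i then γ i else 0).comp hJ) hb
  refine ⟨hc.1, fun ω => ?_, hc.2⟩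
  rw [stepNoise, abs_mul]
  refine mul_le_mul (hb ω) ((abs_sub _ _).trans ?_) (abs_nonneg _) (by assumption)
  have h1 := abs_increment_le hα (est t ω (X t ω)) (Y t ω) (thr t ω)
  have h2 := abs_incrementMass_le P hα (est t ω) (thr t ω)
  linarith

end IsModel

/-! ### Pathwise bounds on the good event. -/

section Deterministic

variable {Ω : Type*} {d K : ℕ} [NeZero K] {P : Measure (Feature d × Fin K)}
  [IsProbabilityMeasure P] {α : ℝ} {γ : ℕ → ℝ} {q₁ : ℝ}
  {est : ℕ → Ω → Feature d → Fin K → ℝ} {X : ℕ → Ω → Feature d} {Y : ℕ → Ω → Fin K}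
  {M q₀ b r m h₀ : ℝ}

local notation "thr" => threshold α γ q₁ est X Y
local notation "cnt" => counter α γ q₁ est X Y
local notation "law" => Measure.map (fun z => topProb P (Prod.fst z)) P

theorem counter_eq_add_sum {s t : ℕ} (hs : 1 ≤ s) (hst : s ≤ t) (ω : Ω) :
    (cnt t ω : ℝ) = cnt s ω + ∑ k ∈ Finset.Ico s t, selInd (est k ω (X k ω)) (thr k ω) := by
  induction t, hst using Nat.le_induction with
  | base => simp
  | succ t hst ih =>
    rw [counter_succ (hs.trans hst), ih, Finset.sum_Ico_succ_top hst]
    ring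

/-- If the threshold stays below `b`, the scores are accurate and the selection noise is small
over `[s, 2s)`, then a positive fraction of these rounds is selected. -/
theorem le_counter (hM : ∀ u w : ℝ, u ≤ w → (law).real (Icc u w) ≤ M * (w - u))
    (hh₀ : h₀ = (law).real (Ioi b)) {s : ℕ} (hs : 1 ≤ s) {ω : Ω} {ε : ℝ} (hε : 0 < ε)
    (hest : ∀ k, 1 ≤ k → Measurable (est k ω))
    (hrange : ∀ k, 1 ≤ k → ∀ x y, est k ω x y ∈ Icc (0 : ℝ) 1)
    (herr : ∀ k ∈ Finset.Ico s (2 * s), ∫ z, scoreError P (est k ω) z.1 ∂P ≤ ε)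
    (hb : ∀ k ∈ Finset.Ico s (2 * s), thr k ω ≤ b) (hsmall : (2 * M + 1) * √ε ≤ h₀ / 2)
    (hnoise : |∑ k ∈ Finset.Ico s (2 * s), selNoise P α γ q₁ est X Y k ω| ≤ h₀ / 4 * s) :
    h₀ / 4 * s ≤ cnt (2 * s) ω := by
  -- For a threshold below `b` the true selection probability is at least `h₀`; the bias costs at
  -- most half of it, and the noise later half of the remainder.
  have h1 : ∀ k ∈ Finset.Ico s (2 * s), h₀ / 2 ≤ selMass P (est k ω) (thr k ω) := by
    intro k hk
    have hk1 : 1 ≤ k := hs.trans (Finset.mem_Ico.1 hk).1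
    have h2 := (abs_le.1 (abs_selMass_sub_le P (hest k hk1) hM (hrange k hk1) hε (herr k hk)
      (thr k ω))).1
    have h3 : h₀ ≤ (law).real (Ioi (thr k ω)) := by
      rw [hh₀]; exact measureReal_mono (Ioi_subset_Ioi (hb k hk))
    linarith
  have h2 : h₀ / 2 * s ≤ ∑ k ∈ Finset.Ico s (2 * s), selMass P (est k ω) (thr k ω) := by
    have := Finset.card_nsmul_le_sum _ _ _ h1
    rw [Nat.card_Ico, show 2 * s - s = s by omega, nsmul_eq_mul] at this
    linarith
  have h3 := (abs_le.1 hnoise).1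
  simp only [selNoise, Finset.sum_sub_distrib] at h3
  rw [counter_eq_add_sum hs (by omega)]
  have h4 : (0 : ℝ) ≤ cnt s ω := Nat.cast_nonneg _
  linarith

/-- Half of the drift `m * η` pays for the bias and the other half remains as push. -/
theorem pushed_above (hM : ∀ u w : ℝ, u ≤ w → (law).real (Icc u w) ≤ M * (w - u))
    (hα : α ∈ Ioo (0 : ℝ) 1) {v : Feature d → Fin K → ℝ} (hv : Measurable v)
    (hrange : ∀ x y, v x y ∈ Icc (0 : ℝ) 1) {ε η : ℝ} (hε : 0 < ε) (hε1 : ε ≤ 1)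
    (herr : ∫ z, scoreError P v z.1 ∂P ≤ ε) (hη : (2 * M + 3) * √ε ≤ m * η / 2) {q : ℝ}
    (hq : 0 ≤ q) (hdrift : drift law (1 - α) q ≤ -(m * η)) :
    incrementMass P α v q ≤ -(m * η / 2) := by
  rw [incrementMass_of_nonneg P hv hq]
  have h2 := (abs_le.1 (abs_errMass_sub_le P hv hM hrange hε hε1 herr q ⟨hα.1.le, hα.2.le⟩)).2
  linarith

/-- For `q ≥ 0` the bias again costs half of the drift; for `q < 0` the mean increment is exactly `1
- α`, which explains `hηα`. -/
theorem pushed_below (hM : ∀ u w : ℝ, u ≤ w → (law).real (Icc u w) ≤ M * (w - u))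
    (hα : α ∈ Ioo (0 : ℝ) 1) {v : Feature d → Fin K → ℝ} (hv : Measurable v)
    (hrange : ∀ x y, v x y ∈ Icc (0 : ℝ) 1) {ε η : ℝ} (hε : 0 < ε) (hε1 : ε ≤ 1)
    (herr : ∫ z, scoreError P v z.1 ∂P ≤ ε) (hη : (2 * M + 3) * √ε ≤ m * η / 2)
    (hηα : m * η / 2 ≤ 1 - α) {q : ℝ} (hdrift : m * η ≤ drift law (1 - α) q) :
    m * η / 2 ≤ incrementMass P α v q := by
  rcases lt_or_ge q 0 with hq | hq
  · rw [incrementMass_of_neg P (fun x y => (hrange x y).1) hq]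
    exact hηα
  · rw [incrementMass_of_nonneg P hv hq]
    have h2 := (abs_le.1 (abs_errMass_sub_le P hv hM hrange hε hε1 herr q ⟨hα.1.le, hα.2.le⟩)).1
    linarith

/-- On the event that the scores are accurate, the threshold stays below `b` and the noise is
small, the threshold is close to `q₀`. -/
theorem abs_threshold_sub_le
    (hM : ∀ u w : ℝ, u ≤ w → (law).real (Icc u w) ≤ M * (w - u)) (hα : α ∈ Ioo (0 : ℝ) 1)
    (hq₁ : q₁ ∈ Icc (0 : ℝ) (1 - α)) {c ρ g : ℝ} (hγ : ∀ i, 1 ≤ i → γ i ∈ Icc 0 c)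
    (hrange : ∀ k, 1 ≤ k → ∀ ω x y, est k ω x y ∈ Icc (0 : ℝ) 1)
    (hq₀ : q₀ ∈ Ioo (0 : ℝ) 1) (hm : 0 < m)
    (hdrift : ∀ η ∈ Ioc 0 r, (∀ q ≤ q₀ - η, m * η ≤ drift law (1 - α) q) ∧
      ∀ q ∈ Icc (q₀ + η) b, drift law (1 - α) q ≤ -(m * η))
    {s t j : ℕ} (hs : 1 ≤ s) (hst : s ≤ t) {ω : Ω} {ε η D : ℝ} (hε : 0 < ε) (hε1 : ε ≤ 1)
    (hest : ∀ k, 1 ≤ k → Measurable (est k ω))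
    (herr : ∀ k ∈ Ico s t, ∫ z, scoreError P (est k ω) z.1 ∂P ≤ ε)
    (hb : ∀ k ∈ Ico s t, thr k ω ≤ b) (hcnt : j ≤ cnt s ω)
    (hγj : ∀ i, j ≤ i → γ i ≤ ρ) (hγt : ∀ i, 1 ≤ i → i ≤ t → g ≤ γ i) (hg : 0 ≤ g)
    (hη : η ∈ Ioc 0 r) (hηε : (2 * M + 3) * √ε ≤ m * η / 2) (hηα : m * η / 2 ≤ 1 - α)
    (hD0 : 0 ≤ D)
    (hD : ∀ i ∈ Ico s t, |∑ k ∈ Finset.Ico i t, stepNoise P α γ q₁ est X Y j k ω| ≤ D)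
    (hfar : 1 + c + D ≤ g * (m * η / 2) * (t - s : ℕ)) :
    |thr t ω - q₀| ≤ η + ρ + D := by
  have hα' : α ∈ Icc (0 : ℝ) 1 := ⟨hα.1.le, hα.2.le⟩
  have hρ : 0 ≤ ρ := (hγ _ (one_le_counter (α := α) (γ := γ) (q₁ := q₁) (est := est) (X := X)
    (Y := Y) hs ω)).1.trans (hγj _ hcnt)
  have hmη : 0 ≤ m * η / 2 := by have := mul_pos hm hη.1; linarith
  have hk1 : ∀ k ∈ Ico s t, 1 ≤ k := fun k hk => hs.trans hk.1
  have hck : ∀ k ∈ Ico s t, j ≤ cnt k ω := fun k hk => hcnt.trans (counter_mono hs hk.1 ω)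
  -- The counter at round `k` is at most `k ≤ t`, so steps are never smaller than those of a run
  -- that selects every point.
  have hgk : ∀ k ∈ Ico s t, g ≤ γ (cnt k ω) := fun k hk =>
    hγt _ (one_le_counter (hk1 k hk) ω) ((counter_le (hk1 k hk) ω).trans hk.2.le)
  refine abs_le_of_pushed (x := fun k => thr k ω - q₀)
    (u := fun k => γ (cnt k ω) * incrementMass P α (est k ω) (thr k ω))
    (ξ := fun k => stepNoise P α γ q₁ est X Y j k ω) (θ := g * (m * η / 2)) hst ?_ ?_ ?_
    (mul_nonneg hg hmη) ?_ hρ ?_ ?_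
  · intro k hk
    simp only [stepNoise, if_pos (hck k hk), threshold_succ (hk1 k hk)]
    ring
  · intro k hk hx
    have h1 := pushed_above hM hα (hest k (hk1 k hk)) (hrange k (hk1 k hk) ω) hε hε1 (herr k hk)
      hηε (q := thr k ω) (by linarith [hq₀.1, hη.1])
      ((hdrift η hη).2 _ ⟨by linarith, hb k hk⟩)
    have h2 := mul_le_mul_of_nonneg_right (hgk k hk) hmη
    have h3 := mul_le_mul_of_nonneg_left h1 (hg.trans (hgk k hk))
    linarith
  · intro k hk hx
    have h1 := pushed_below hM hα (hest k (hk1 k hk)) (hrange k (hk1 k hk) ω) hε hε1 (herr k hk)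
      hηε hηα (q := thr k ω) ((hdrift η hη).1 _ (by linarith))
    exact mul_le_mul (hgk k hk) h1 hmη (hg.trans (hgk k hk))
  · intro k hk
    have h1 : thr (k + 1) ω - q₀ - (thr k ω - q₀)
        = γ (cnt k ω) * increment α (est k ω (X k ω)) (Y k ω) (thr k ω) := by
      rw [threshold_succ (hk1 k hk)]; ring
    rw [h1, abs_mul, abs_of_nonneg (hg.trans (hgk k hk))]
    exact (mul_le_of_le_one_right (hg.trans (hgk k hk)) (abs_increment_le hα' _ _ _)).trans
      (hγj _ (hck k hk))
  · intro i hi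
    rcases hi.2.lt_or_eq with hlt | rfl
    · exact hD i ⟨hi.1, hlt⟩
    · simpa using hD0
  · have h1 := threshold_mem (X := X) (Y := Y) hα' hγ hq₁ hrange hs ω
    have h2 : |thr s ω - q₀| ≤ 1 + c :=
      abs_le.2 ⟨by linarith [h1.1, hq₀.2], by linarith [h1.2, hq₀.1]⟩
    linarith [hη.1]

/-- The error rate is close to `α` when the threshold is close to `q₀`. -/
theorem abs_errMass_div_selMass_sub_le
    (hM : ∀ u w : ℝ, u ≤ w → (law).real (Icc u w) ≤ M * (w - u)) (hα : α ∈ Icc (0 : ℝ) 1)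
    {v : Feature d → Fin K → ℝ} (hv : Measurable v)
    (hrange : ∀ x y, v x y ∈ Icc (0 : ℝ) 1) {ε : ℝ} (hε : 0 < ε) (hε1 : ε ≤ 1)
    (herr : ∫ z, scoreError P v z.1 ∂P ≤ ε) (hh : 0 < h₀) (hh₀ : h₀ = (law).real (Ioi b))
    (hsmall : (2 * M + 1) * √ε ≤ h₀ / 2) {q : ℝ} (hq : q ≤ b)
    (hlip : |drift law (1 - α) q - drift law (1 - α) q₀| ≤ M * |q - q₀|)
    (hzero : drift law (1 - α) q₀ = 0) :
    |errMass P v q / selMass P v q - α| ≤ 2 / h₀ * (M * |q - q₀| + (2 * M + 3) * √ε) := by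
  have h1 := (abs_le.1 (abs_selMass_sub_le P hv hM hrange hε herr q)).1
  have h2 : h₀ ≤ (law).real (Ioi q) := by
    rw [hh₀]; exact measureReal_mono (Ioi_subset_Ioi hq)
  have h3 : h₀ / 2 ≤ selMass P v q := by linarith
  have h4 := abs_errMass_sub_le P hv hM hrange hε hε1 herr q hα
  rw [hzero, sub_zero] at hlip
  have h5 : |errMass P v q - α * selMass P v q| ≤ M * |q - q₀| + (2 * M + 3) * √ε := by
    have := abs_add_le (errMass P v q - α * selMass P v q - drift law (1 - α) q)
      (drift law (1 - α) q)
    rw [sub_add_cancel] at this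
    linarith
  have hpos : 0 < selMass P v q := by linarith
  have h6 : errMass P v q / selMass P v q - α
      = (errMass P v q - α * selMass P v q) / selMass P v q := by
    field_simp
  rw [h6, abs_div, abs_of_pos hpos, div_le_iff₀ hpos]
  refine h5.trans ?_
  have h7 : 0 ≤ M * |q - q₀| + (2 * M + 3) * √ε := (abs_nonneg _).trans h5
  calc _ = 2 / h₀ * (M * |q - q₀| + (2 * M + 3) * √ε) * (h₀ / 2) := by field_simp
    _ ≤ _ := mul_le_mul_of_nonneg_left h3 (mul_nonneg (by positivity) h7)

end Deterministic

/-! ### Probability of the exceptional events. -/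

namespace IsModel

variable {Ω : Type*} {m0 : MeasurableSpace Ω} {μ : Measure Ω} [IsProbabilityMeasure μ]
  {d K n : ℕ} [NeZero K] {P : Measure (Feature d × Fin K)} [IsProbabilityMeasure P]
  {X : ℕ → Ω → Feature d} {Y : ℕ → Ω → Fin K}
  {D0 : Ω → Fin n → Feature d × Fin K} {est : ℕ → Ω → Feature d → Fin K → ℝ}
  (h : IsModel μ P X Y D0 est) {α : ℝ} {γ : ℕ → ℝ} {q₁ : ℝ}

local notation "thr" => threshold α γ q₁ est X Y

omit [IsProbabilityMeasure μ] [IsProbabilityMeasure P] in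
include h in
theorem measurable_est_apply {t : ℕ} (ht : 1 ≤ t) (ω : Ω) : Measurable (est t ω) :=
  measurable_score_apply (h.measurable_est t ht) ω

include h in
theorem measure_scoreError_eq {t : ℕ} (ht : 1 ≤ t) (x : ℝ) :
    μ.real {ω | x ≤ ∫ z, scoreError P (est t ω) z.1 ∂P}
      = μ.real {ω | x ≤ (μ[fun ω' => scoreError P (est t ω') (X t ω') |
          history D0 X Y (t - 1)]) ω} := by
  refine measureReal_congr ?_
  filter_upwards [h.condExp_scoreError ht] with ω hω
  exact propext (by
    change x ≤ ∫ z, scoreError P (est t ω) z.1 ∂P ↔ x ≤ _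
    rw [hω])

theorem exp_neg_le_inv {x : ℝ} (hx : 0 < x) : Real.exp (-x) ≤ 1 / x := by
  rw [Real.exp_neg, ← one_div]
  exact one_div_le_one_div_of_le hx (by linarith [Real.add_one_le_exp x])

omit [NeZero K] in
theorem monotone_history_pred : Monotone fun k => history D0 X Y (k - 1) := fun _ _ hkl =>
  history_mono (Nat.sub_le_sub_right hkl 1)

include h in
-- Azuma-Hoeffding gives exponential decay in `s`; only `O(1/s)` is needed, so `exp_neg_le_inv`
-- suffices.
theorem measure_selNoise_le {s : ℕ} (hs : 1 ≤ s) {h₀ : ℝ} (hh : 0 < h₀) :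
    μ.real {ω | h₀ / 4 * s ≤ |∑ k ∈ Finset.Ico s (2 * s), selNoise P α γ q₁ est X Y k ω|}
      ≤ 64 / (h₀ ^ 2 * s) := by
  have hs0 : (0 : ℝ) < s := by exact_mod_cast hs
  have hspec := fun k (hk : s ≤ k) =>
    h.selNoise_spec (α := α) (γ := γ) (q₁ := q₁) (hs.trans hk)
  have h1 := measure_abs_sum_ge_le (μ := μ) monotone_history_pred (fun k => h.history_le (k - 1))
    one_pos (fun k hk => (hspec k hk).1) (fun k hk => (hspec k hk).2.1)
    (fun k hk => (hspec k hk).2.2) (j := 2 * s) hs0 (by omega)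
    (by rw [show 2 * s - s = s by omega]) (x := h₀ / 4 * s) (by positivity)
  refine h1.trans ?_
  have h2 := exp_neg_le_inv (x := (h₀ / 4 * s) ^ 2 / (2 * 1 ^ 2 * s)) (by positivity)
  calc _ ≤ 2 * (1 / ((h₀ / 4 * s) ^ 2 / (2 * 1 ^ 2 * s))) := by linarith
    _ = _ := by field_simp; norm_num

include h in
theorem measure_stepNoise_le (hα : α ∈ Icc (0 : ℝ) 1) {j s t : ℕ} (hs : 1 ≤ s) (ht : 2 ≤ t)
    {ρ : ℝ} (hρ : 0 < ρ) (hγ : ∀ i, j ≤ i → |γ i| ≤ ρ) :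
    μ.real (⋃ i ∈ Finset.Ico s t, {ω | 4 * ρ * √(t * Real.log t)
        ≤ |∑ k ∈ Finset.Ico i t, stepNoise P α γ q₁ est X Y j k ω|}) ≤ 2 / t := by
  have ht0 : (0 : ℝ) < t := by exact_mod_cast (by omega : 0 < t)
  have hlog : 0 ≤ Real.log t := Real.log_natCast_nonneg t
  have h1 : ∀ i ∈ Finset.Ico s t, μ.real {ω | 4 * ρ * √(t * Real.log t)
        ≤ |∑ k ∈ Finset.Ico i t, stepNoise P α γ q₁ est X Y j k ω|} ≤ 2 / (t : ℝ) ^ 2 := by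
    intro i hi
    obtain ⟨hsi, hit⟩ := Finset.mem_Ico.1 hi
    have hspec := fun k (hk : i ≤ k) =>
      h.stepNoise_spec (q₁ := q₁) hα hρ.le hγ (hs.trans (hsi.trans hk))
    have h2 := measure_abs_sum_ge_le (μ := μ) monotone_history_pred
      (fun k => h.history_le (k - 1)) (by linarith : 0 < ρ * 2) (fun k hk => (hspec k hk).1)
      (fun k hk => (hspec k hk).2.1) (fun k hk => (hspec k hk).2.2) ht0 hit.le
      (by exact_mod_cast Nat.sub_le t i) (x := 4 * ρ * √(t * Real.log t)) (by positivity)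
    refine h2.trans (le_of_eq ?_)
    -- The factor `4` makes the exponent `-2 log t`, so each starting index costs `2/t²` and the
    -- union over at most `t` of them costs `2/t`.
    have h3 : -((4 * ρ * √(t * Real.log t)) ^ 2 / (2 * (ρ * 2) ^ 2 * t))
        = -(Real.log t + Real.log t) := by
      rw [mul_pow, Real.sq_sqrt (by positivity)]
      field_simp
      ring
    rw [h3, Real.exp_neg, Real.exp_add, Real.exp_log ht0]
    field_simp
  refine (measureReal_biUnion_finset_le _ _).trans ((Finset.sum_le_card_nsmul _ _ _ h1).trans ?_)
  rw [Nat.card_Ico, nsmul_eq_mul]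
  have h4 : ((t - s : ℕ) : ℝ) ≤ t := by exact_mod_cast Nat.sub_le t s
  calc _ ≤ (t : ℝ) * (2 / (t : ℝ) ^ 2) := mul_le_mul_of_nonneg_right h4 (by positivity)
    _ = _ := by field_simp

variable {M q₀ b r m h₀ : ℝ}

local notation "lawW" => Measure.map (fun z => topProb P (Prod.fst z)) P

include h in
/-- The probability that the error rate or the threshold is far from its target at round `t`. -/
theorem measure_far_le
    (hM0 : 0 ≤ M) (hM : ∀ u w : ℝ, u ≤ w → (lawW).real (Icc u w) ≤ M * (w - u))
    (hα : α ∈ Ioo (0 : ℝ) 1)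
    (hq₁ : q₁ ∈ Icc (0 : ℝ) (1 - α)) {c ρ g : ℝ} (hγ : ∀ i, 1 ≤ i → γ i ∈ Icc 0 c)
    (hq₀ : q₀ ∈ Ioo (0 : ℝ) 1) (hm : 0 < m)
    (hlip : ∀ q q', |drift lawW (1 - α) q - drift lawW (1 - α) q'| ≤ M * |q - q'|)
    (hzero : drift lawW (1 - α) q₀ = 0)
    (hdrift : ∀ η ∈ Ioc 0 r, (∀ q ≤ q₀ - η, m * η ≤ drift lawW (1 - α) q) ∧
      ∀ q ∈ Icc (q₀ + η) b, drift lawW (1 - α) q ≤ -(m * η))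
    (hh : 0 < h₀) (hh₀ : h₀ = (lawW).real (Ioi b))
    {s t t₀ : ℕ} (hs : 1 ≤ s) (ht₀ : t₀ ≤ s) (hst : 2 * s ≤ t) {ε η p : ℝ} (hε : 0 < ε)
    (hε1 : ε ≤ 1) (hsmall : (2 * M + 1) * √ε ≤ h₀ / 2) (hρ : 0 < ρ)
    (hγj : ∀ i : ℕ, h₀ / 4 * s ≤ i → γ i ≤ ρ) (hγt : ∀ i, 1 ≤ i → i ≤ t → g ≤ γ i) (hg : 0 ≤ g)
    (hη : η ∈ Ioc 0 r) (hηε : (2 * M + 3) * √ε ≤ m * η / 2) (hηα : m * η / 2 ≤ 1 - α)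
    (hfar : 1 + c + 4 * ρ * √(t * Real.log t) ≤ g * (m * η / 2) * (t - 2 * s : ℕ))
    (hrate : ∀ k ∈ Finset.Icc s t, μ.real {ω | ε ≤ (μ[fun ω' =>
      scoreError P (est k ω') (X k ω') | history D0 X Y (k - 1)]) ω} ≤ p) :
    μ.real {ω | ¬ |instErrorRate μ D0 est X Y thr t ω - α| + |thr t ω - q₀|
        ≤ (1 + 2 / h₀ * M) * (η + ρ + 4 * ρ * √(t * Real.log t)) + 2 / h₀ * ((2 * M + 3) * √ε)}
      ≤ μ.real {ω | ∃ T, t₀ ≤ T ∧ b < thr T ω} + (t - s + 1 : ℕ) * p + 64 / (h₀ ^ 2 * s)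
        + 2 / t := by
  have hα' : α ∈ Icc (0 : ℝ) 1 := ⟨hα.1.le, hα.2.le⟩
  set D := 4 * ρ * √(t * Real.log t) with hD
  have hD0 : 0 ≤ D := by positivity
  set j := ⌈h₀ / 4 * s⌉₊ with hj
  have hs0 : (0 : ℝ) < s := by exact_mod_cast hs
  have hj1 : 1 ≤ j := Nat.ceil_pos.2 (by positivity)
  have hγj' : ∀ i, j ≤ i → γ i ≤ ρ := fun i hi => hγj i (Nat.ceil_le.1 hi)
  -- The five exceptional events: the threshold exceeds `b`, the scores are inaccurate, the
  -- selection noise is large, the step noise is large, the formula for the error rate fails.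
  set A₁ : Set Ω := {ω | ∃ T, t₀ ≤ T ∧ b < thr T ω}
  set A₂ : Set Ω := ⋃ k ∈ Finset.Icc s t, {ω | ε ≤ ∫ z, scoreError P (est k ω) z.1 ∂P}
  set A₃ : Set Ω := {ω | h₀ / 4 * s
    ≤ |∑ k ∈ Finset.Ico s (2 * s), selNoise P α γ q₁ est X Y k ω|}
  set A₄ : Set Ω := ⋃ i ∈ Finset.Ico (2 * s) t, {ω | D
    ≤ |∑ k ∈ Finset.Ico i t, stepNoise P α γ q₁ est X Y j k ω|}
  set A₅ : Set Ω := {ω | ¬ instErrorRate μ D0 est X Y thr t ω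
    = errMass P (est t ω) (thr t ω) / selMass P (est t ω) (thr t ω)}
  have h₁ : μ.real A₂ ≤ (t - s + 1 : ℕ) * p := by
    refine (measureReal_biUnion_finset_le _ _).trans ?_
    refine (Finset.sum_le_card_nsmul _ _ p fun k hk => ?_).trans ?_
    · rw [h.measure_scoreError_eq (hs.trans (Finset.mem_Icc.1 hk).1)]
      exact hrate k hk
    · rw [Nat.card_Icc, nsmul_eq_mul, show t + 1 - s = t - s + 1 by omega]
  have h₂ : μ.real A₃ ≤ 64 / (h₀ ^ 2 * s) := h.measure_selNoise_le hs hh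
  have h₃ : μ.real A₄ ≤ 2 / t :=
    h.measure_stepNoise_le hα' (by omega) (by omega) hρ fun i hi => by
      rw [abs_of_nonneg (hγ i (hj1.trans hi)).1]; exact hγj' i hi
  have h₄ : μ.real A₅ = 0 := by
    rw [measureReal_eq_zero_iff]
    exact h.instErrorRate_ae_eq (by omega)
  have hsub : {ω | ¬ |instErrorRate μ D0 est X Y thr t ω - α| + |thr t ω - q₀|
        ≤ (1 + 2 / h₀ * M) * (η + ρ + D) + 2 / h₀ * ((2 * M + 3) * √ε)}
      ⊆ A₁ ∪ A₂ ∪ A₃ ∪ A₄ ∪ A₅ := by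
    intro ω hω
    by_contra hcon
    simp only [mem_union, not_or] at hcon
    obtain ⟨⟨⟨⟨n₁, n₂⟩, n₃⟩, n₄⟩, n₅⟩ := hcon
    refine hω ?_
    have hbd : ∀ k, s ≤ k → thr k ω ≤ b := fun k hk => by
      by_contra hlt
      exact n₁ ⟨k, ht₀.trans hk, not_le.1 hlt⟩
    have herr : ∀ k, s ≤ k → k ≤ t → ∫ z, scoreError P (est k ω) z.1 ∂P ≤ ε := fun k hk hk' => by
      by_contra hlt
      exact n₂ (mem_biUnion (Finset.mem_coe.2 (Finset.mem_Icc.2 ⟨hk, hk'⟩)) (not_le.1 hlt).le)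
    have hnoise : ∀ i ∈ Ico (2 * s) t,
        |∑ k ∈ Finset.Ico i t, stepNoise P α γ q₁ est X Y j k ω| ≤ D := fun i hi => by
      by_contra hlt
      exact n₄ (mem_biUnion (Finset.mem_coe.2 (Finset.mem_Ico.2 hi)) (not_le.1 hlt).le)
    have hest : ∀ k, 1 ≤ k → Measurable (est k ω) := fun k hk => h.measurable_est_apply hk ω
    have hcnt : j ≤ counter α γ q₁ est X Y (2 * s) ω := Nat.ceil_le.2
      (le_counter hM hh₀ hs hε hest (fun k hk => h.range k hk ω)
        (fun k hk => herr k (Finset.mem_Ico.1 hk).1 ((Finset.mem_Ico.1 hk).2.le.trans hst))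
        (fun k hk => hbd k (Finset.mem_Ico.1 hk).1) hsmall (not_le.1 n₃).le)
    have hthr : |thr t ω - q₀| ≤ η + ρ + D :=
      abs_threshold_sub_le hM hα hq₁ hγ h.range hq₀ hm hdrift (by omega) hst hε hε1 hest
        (fun k hk => herr k (by have := hk.1; omega) hk.2.le)
        (fun k hk => hbd k (by have := hk.1; omega)) hcnt hγj' hγt hg hη hηε hηα hD0 hnoise hfar
    have hier := abs_errMass_div_selMass_sub_le hM hα' (hest t (by omega))
      (h.range t (by omega) ω) hε hε1 (herr t (by omega) le_rfl) hh hh₀ hsmall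
      (hbd t (by omega)) (hlip _ q₀) hzero
    have n₅' : instErrorRate μ D0 est X Y thr t ω
      = errMass P (est t ω) (thr t ω) / selMass P (est t ω) (thr t ω) := not_not.1 n₅
    rw [n₅']
    have h5 : 2 / h₀ * (M * |thr t ω - q₀|) ≤ 2 / h₀ * (M * (η + ρ + D)) :=
      mul_le_mul_of_nonneg_left (mul_le_mul_of_nonneg_left hthr hM0) (by positivity)
    rw [mul_add] at hier
    linarith
  calc _ ≤ μ.real (A₁ ∪ A₂ ∪ A₃ ∪ A₄ ∪ A₅) := measureReal_mono hsub
    _ ≤ μ.real A₁ + μ.real A₂ + μ.real A₃ + μ.real A₄ + μ.real A₅ := by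
      refine (measureReal_union_le _ _).trans (add_le_add_left ?_ _)
      refine (measureReal_union_le _ _).trans (add_le_add_left ?_ _)
      refine (measureReal_union_le _ _).trans (add_le_add_left ?_ _)
      exact measureReal_union_le _ _
    _ ≤ _ := by linarith

end IsModel

/-! ### Rates in `t`. -/

theorem tendsto_log_rpow_mul_rpow_neg (p : ℝ) {s : ℝ} (hs : 0 < s) :
    Tendsto (fun t : ℕ => Real.log t ^ p * (t : ℝ) ^ (-s)) atTop (nhds 0) := by
  have h1 := (isLittleO_log_rpow_rpow_atTop p hs).tendsto_div_nhds_zero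
  refine (h1.comp tendsto_natCast_atTop_atTop).congr fun t => ?_
  rw [Function.comp_apply, Real.rpow_neg (Nat.cast_nonneg t), div_eq_mul_inv]

theorem tendsto_natCast_rpow_neg {s : ℝ} (hs : 0 < s) :
    Tendsto (fun t : ℕ => (t : ℝ) ^ (-s)) atTop (nhds 0) :=
  (tendsto_rpow_neg_atTop hs).comp tendsto_natCast_atTop_atTop

theorem eighth_le_natCast_div_four {t : ℕ} (ht : 8 ≤ t) : (t : ℝ) / 8 ≤ ((t / 4 : ℕ) : ℝ) := by
  have h : t ≤ 8 * (t / 4) := by omega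
  have h' : (t : ℝ) ≤ 8 * ((t / 4 : ℕ) : ℝ) := by exact_mod_cast h
  linarith

theorem half_le_natCast_sub (t : ℕ) : (t : ℝ) / 2 ≤ ((t - 2 * (t / 4) : ℕ) : ℝ) := by
  have h : t ≤ 2 * (t - 2 * (t / 4)) := by omega
  have h' : (t : ℝ) ≤ 2 * ((t - 2 * (t / 4) : ℕ) : ℝ) := by exact_mod_cast h
  linarith

theorem mul_rpow_neg_le_of_le {c x β t : ℝ} (hc : 0 ≤ c) (hβ : 0 ≤ β) (ht : 0 < t) {i : ℝ}
    (hx : 0 < x) (hi : x * t ≤ i) : c * i ^ (-β) ≤ c * x ^ (-β) * t ^ (-β) := by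
  rw [mul_assoc, ← Real.mul_rpow hx.le ht.le]
  exact mul_le_mul_of_nonneg_left
    (Real.rpow_le_rpow_of_nonpos (mul_pos hx ht) hi (by linarith)) hc

theorem one_le_log_natCast {t : ℕ} (ht : 3 ≤ t) : 1 ≤ Real.log t := by
  have h3 : (3 : ℝ) ≤ t := by exact_mod_cast ht
  rw [Real.le_log_iff_exp_le (by linarith)]
  linarith [Real.exp_one_lt_d9]

/-- The rate of the estimators over the window `[t / 4, t]` in terms of `t`. -/
theorem log_rpow_mul_rpow_le {C₁ ν₀ ν : ℝ} (hC₁ : 0 ≤ C₁) (hν₀ : 0 ≤ ν₀) (hν : 0 ≤ ν) {k t : ℕ}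
    (ht : 8 ≤ t) (hk : t / 4 ≤ k) (hkt : k ≤ t) :
    C₁ * Real.log k ^ ν₀ * (k : ℝ) ^ (-ν)
      ≤ (√(C₁ * (1 / 8 : ℝ) ^ (-ν)) * (Real.log t ^ (ν₀ / 2) * (t : ℝ) ^ (-ν / 2))) ^ 2 := by
  have ht0 : (0 : ℝ) < t := by exact_mod_cast (by omega : 0 < t)
  have hk0 : (0 : ℝ) < k := by exact_mod_cast (by omega : 0 < k)
  have hl : 0 ≤ Real.log t := Real.log_natCast_nonneg t
  have e : (√(C₁ * (1 / 8 : ℝ) ^ (-ν)) * (Real.log t ^ (ν₀ / 2) * (t : ℝ) ^ (-ν / 2))) ^ 2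
      = Real.log t ^ ν₀ * (C₁ * (1 / 8 : ℝ) ^ (-ν) * (t : ℝ) ^ (-ν)) := by
    rw [mul_pow, mul_pow, Real.sq_sqrt (by positivity), ← Real.rpow_mul_natCast hl,
      ← Real.rpow_mul_natCast ht0.le]
    have e1 : ν₀ / 2 * (2 : ℕ) = ν₀ := by push_cast; ring
    have e2 : -ν / 2 * (2 : ℕ) = -ν := by push_cast; ring
    rw [e1, e2]
    ring
  rw [e]
  have h1 : C₁ * (k : ℝ) ^ (-ν) ≤ C₁ * (1 / 8 : ℝ) ^ (-ν) * (t : ℝ) ^ (-ν) := by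
    refine mul_rpow_neg_le_of_le hC₁ hν ht0 (by norm_num) ?_
    have h2 := eighth_le_natCast_div_four ht
    have h3 : ((t / 4 : ℕ) : ℝ) ≤ k := by exact_mod_cast hk
    linarith
  have h2 : Real.log k ^ ν₀ ≤ Real.log t ^ ν₀ :=
    Real.rpow_le_rpow (Real.log_natCast_nonneg k)
      (Real.log_le_log hk0 (by exact_mod_cast hkt)) hν₀
  calc _ = Real.log k ^ ν₀ * (C₁ * (k : ℝ) ^ (-ν)) := by ring
    _ ≤ _ := mul_le_mul h2 h1 (by positivity) (Real.rpow_nonneg hl _)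

/-- Here `k ≥ t/8` gives the factor `8³ = 512`, and `3 / π² ≤ 1`. -/
theorem three_div_le {k t : ℕ} (ht : 8 ≤ t) (hk : t / 4 ≤ k) :
    3 / (Real.pi ^ 2 * (k : ℝ) ^ 3) ≤ 512 / (t : ℝ) ^ 3 := by
  have ht0 : (0 : ℝ) < t := by exact_mod_cast (by omega : 0 < t)
  have h1 : (t : ℝ) / 8 ≤ k :=
    (eighth_le_natCast_div_four ht).trans (by exact_mod_cast hk)
  have h2 : ((t : ℝ) / 8) ^ 3 ≤ (k : ℝ) ^ 3 := pow_le_pow_left₀ (by positivity) h1 3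
  have h3 : (3 : ℝ) ≤ Real.pi ^ 2 := by nlinarith [Real.pi_gt_three]
  calc _ ≤ 3 / (3 * ((t : ℝ) / 8) ^ 3) := by gcongr
    _ = _ := by field_simp; norm_num

/-- Step size times the Azuma scale `√(t log t)` is the first term of `rho`. -/
theorem sqrt_mul_log_eq {β : ℝ} {t : ℕ} (ht : 1 ≤ t) :
    (t : ℝ) ^ (-β) * √(t * Real.log t)
      = Real.log t ^ (1 / 2 : ℝ) * (t : ℝ) ^ (1 / 2 - β) := by
  have ht0 : (0 : ℝ) < t := by exact_mod_cast ht
  rw [Real.sqrt_mul ht0.le, Real.sqrt_eq_rpow, Real.sqrt_eq_rpow, sub_eq_add_neg,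
    Real.rpow_add ht0]
  ring

/-- The step size is at most of the order of the accumulated noise. -/
theorem rpow_neg_le_rho {β : ℝ} {t : ℕ} (ht : 3 ≤ t) :
    (t : ℝ) ^ (-β) ≤ Real.log t ^ (1 / 2 : ℝ) * (t : ℝ) ^ (1 / 2 - β) := by
  have ht1 : (1 : ℝ) ≤ t := by exact_mod_cast (by omega : 1 ≤ t)
  have h1 := Real.one_le_rpow (one_le_log_natCast ht) (by norm_num : (0 : ℝ) ≤ 1 / 2)
  have h2 := Real.rpow_le_rpow_of_exponent_le ht1 (by linarith : -β ≤ 1 / 2 - β)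
  have h3 : (0 : ℝ) ≤ (t : ℝ) ^ (1 / 2 - β) := by positivity
  nlinarith

end OnlineSCI

/-! ### The main theorem. -/

set_option maxHeartbeats 1000000 in
theorem mainTheorem9
    {Ω : Type*} [MeasurableSpace Ω] (μ : Measure Ω) [IsProbabilityMeasure μ]
    {d K n : ℕ} [NeZero K]
    -- the iid classification model, with an independent holdout sample `D0`
    (P : Measure (OnlineSCI.Feature d × Fin K)) [IsProbabilityMeasure P]
    (X : ℕ → Ω → OnlineSCI.Feature d) (Y : ℕ → Ω → Fin K)
    (D0 : Ω → Fin n → OnlineSCI.Feature d × Fin K)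
    (hX : ∀ t, 1 ≤ t → Measurable (X t)) (hY : ∀ t, 1 ≤ t → Measurable (Y t))
    (hD0 : Measurable D0)
    (hlaw : ∀ t, 1 ≤ t → μ.map (fun ω => (X t ω, Y t ω)) = P)
    (hindep : iIndepFun (fun (t : ℕ) ω => (X (t + 1) ω, Y (t + 1) ω)) μ)
    (hindepD0 : IndepFun D0 (fun ω (t : ℕ) => (X (t + 1) ω, Y (t + 1) ω)) μ)
    -- the law of `W(X)`
    (κ Bstar : ℝ) (hκ : 1 / (K : ℝ) ≤ κ) (hκB : κ < Bstar) (hB : Bstar ≤ 1)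
    (hdens : OnlineSCI.HasContinuousDensityOn
      (P.map (fun z => OnlineSCI.topProb P z.1)) κ Bstar)
    -- the estimated class probabilities, known at time `t - 1`
    (est : ℕ → Ω → OnlineSCI.Feature d → Fin K → ℝ)
    (hest_range : ∀ t, 1 ≤ t → ∀ ω x y, est t ω x y ∈ Icc (0 : ℝ) 1)
    (hest_meas : ∀ t, 1 ≤ t → ∀ y,
      Measurable[(OnlineSCI.history D0 X Y (t - 1)).prod inferInstance]
        (fun p : Ω × OnlineSCI.Feature d => est t p.1 p.2 y))
    (C₁ ν₀ ν : ℝ) (hC₁ : 0 < C₁) (hν₀ : 0 < ν₀) (hν : ν ∈ Ioc (0 : ℝ) (1 / 2))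
    (hest_rate : ∀ᶠ t : ℕ in atTop,
      μ.real {ω | C₁ * Real.log t ^ ν₀ * (t : ℝ) ^ (-ν) ≤
        (μ[fun ω' => OnlineSCI.maxScore (fun y =>
            |est t ω' (X t ω') y - OnlineSCI.classProb P (X t ω') y|)
          | OnlineSCI.history D0 X Y (t - 1)]) ω}
        ≤ 3 / (Real.pi ^ 2 * (t : ℝ) ^ 3))
    -- the level, the step sequence and the starting point
    (α : ℝ) (hα : α ∈ Ioo (0 : ℝ) 1) (hαB : 1 - Bstar < α)
    (hαW : α < 1 - ∫ z, OnlineSCI.topProb P z.1 ∂P)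
    (c β : ℝ) (hc : 0 < c) (hβ : β ∈ Ioo (1 / 2 : ℝ) 1)
    (γ : ℕ → ℝ) (hγ : ∀ j : ℕ, 1 ≤ j → γ j = c * (j : ℝ) ^ (-β))
    (q₁ : ℝ) (hq₁ : q₁ ∈ Icc (0 : ℝ) (1 - α))
    (q : ℕ → Ω → ℝ) (hq : q = OnlineSCI.threshold α γ q₁ est X Y) :
    ∃ q₀ : ℝ,
      (q₀ ∈ Ioo κ (1 - α) ∧ OnlineSCI.condMeanTop P q₀ = 1 - α ∧
        ∀ q' ∈ Ioo κ (1 - α), OnlineSCI.condMeanTop P q' = 1 - α → q' = q₀) ∧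
      ∀ δ' : ℝ, OnlineSCI.failureProb μ q Bstar < δ' →
        ∃ T₀ : ℕ, 1 ≤ T₀ ∧ ∃ C₀ : ℝ, 0 < C₀ ∧ ∀ t : ℕ, T₀ ≤ t →
          1 - δ' - C₀ / t ≤
            μ.real {ω | |OnlineSCI.instErrorRate μ D0 est X Y q t ω - α| + |q t ω - q₀| ≤
              C₀ * (OnlineSCI.rho β t + Real.log t ^ (ν₀ / 2) * (t : ℝ) ^ (-ν / 2))} := by
  classical
  subst hq
  have hmod : OnlineSCI.IsModel μ P X Y D0 est :=
    ⟨hX, hY, hD0, hlaw, hindep, hindepD0, hest_range, fun t ht =>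
      (@measurable_pi_iff (Ω × OnlineSCI.Feature d) (Fin K) (fun _ => ℝ)
        ((OnlineSCI.history D0 X Y (t - 1)).prod inferInstance) _ _).2 (hest_meas t ht)⟩
  have hα' : α ∈ Icc (0 : ℝ) 1 := ⟨hα.1.le, hα.2.le⟩
  have hβ0 : 0 < β := by linarith [hβ.1]
  have hκ0 : 0 ≤ κ := le_trans (by positivity) hκ
  have hprob : IsProbabilityMeasure (P.map fun z => OnlineSCI.topProb P z.1) :=
    Measure.isProbabilityMeasure_map (OnlineSCI.measurable_topProb_fst P).aemeasurable
  have hmean : ∫ w, w ∂(P.map fun z => OnlineSCI.topProb P z.1) < 1 - α := by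
    rw [integral_map (OnlineSCI.measurable_topProb_fst P).aemeasurable
      measurable_id'.aestronglyMeasurable]
    linarith
  have hαB' : 1 - α < Bstar := by linarith
  obtain ⟨M, hM0, hM⟩ := hdens.exists_upper
  obtain ⟨q₀, hq₀, hzero, huniq, hdrift⟩ :=
    OnlineSCI.exists_drift_eq_zero hdens hκ0 hκB hB hαB' hmean
  have hlip := OnlineSCI.abs_drift_sub_le hdens.ae_mem hκ0 hB (a := 1 - α)
    ⟨by linarith [hα.2], by linarith [hα.1]⟩ hM
  have hiff : ∀ q' ∈ Ioo κ (1 - α), OnlineSCI.condMeanTop P q' = 1 - α ↔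
      OnlineSCI.drift (P.map fun z => OnlineSCI.topProb P z.1) (1 - α) q' = 0 := fun q' hq' =>
    OnlineSCI.condMeanTop_eq_iff P (hdens.measure_Ioi_pos hκB (hq'.2.trans hαB'))
  refine ⟨q₀, ⟨hq₀, (hiff q₀ hq₀).2 hzero, fun q' hq' h' => huniq q' hq' ((hiff q' hq').1 h')⟩,
    fun δ' hδ' => ?_⟩
  have hne : {p | ∃ b ∈ Ico 0 Bstar, ∃ t : ℕ, 1 ≤ t ∧ p = μ.real {ω | ∃ T : ℕ, t ≤ T ∧
      b < OnlineSCI.threshold α γ q₁ est X Y T ω}}.Nonempty :=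
    ⟨_, 0, ⟨le_rfl, hκ0.trans_lt hκB⟩, 1, le_rfl, rfl⟩
  -- As `δ'` exceeds the infimum, some level and starting time already have exceedance probability
  -- below `δ'`.
  obtain ⟨_, ⟨b₀, hb₀, t₀, -, rfl⟩, hlt⟩ := exists_lt_of_csInf_lt hne hδ'
  -- Raising the level to at least `1 - α`, as `exists_drift_eq_zero` requires, only shrinks the
  -- exceedance event and stays below `Bstar`.
  set b := max b₀ (1 - α) with hb
  obtain ⟨r, hr, m, hm, hdrift⟩ := hdrift b ⟨le_max_right _ _, max_lt hb₀.2 hαB'⟩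
  set h₀ := (P.map fun z => OnlineSCI.topProb P z.1).real (Ioi b) with hh₀
  have hh : 0 < h₀ := hdens.measure_Ioi_pos hκB (max_lt hb₀.2 hαB')
  have hq₀' : q₀ ∈ Ioo (0 : ℝ) 1 := ⟨by linarith [hq₀.1], by linarith [hq₀.2, hα.1]⟩
  have hγc : ∀ i : ℕ, 1 ≤ i → γ i ∈ Icc 0 c := fun i hi => by
    have hi1 : (1 : ℝ) ≤ i := by exact_mod_cast hi
    rw [hγ i hi]
    exact ⟨by positivity, mul_le_of_le_one_right hc.le
      (Real.rpow_le_one_of_one_le_of_nonpos hi1 (by linarith))⟩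
  -- the constants
  set Cρ : ℝ := c * (h₀ / 32) ^ (-β) with hCρ
  have hCρ0 : 0 < Cρ := by positivity
  set Cε : ℝ := √(C₁ * (1 / 8 : ℝ) ^ (-ν)) with hCε
  have hCε0 : 0 < Cε := Real.sqrt_pos.2 (by positivity)
  -- Chosen so that `c * m * Cη / 4 = 2 + c`: the drift over `t/2` rounds covers the initial
  -- distance `1 + c` plus noise at most 1.
  set Cη : ℝ := 4 * (2 + c) / (c * m) with hCη
  have hCη0 : 0 < Cη := by positivity
  -- Chosen so that `m * (Cη' * E t) / 2` equals the bias `(2 * M + 3) * √ε` with `√ε = Cε * E t`.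
  set Cη' : ℝ := 2 * (2 * M + 3) * Cε / m with hCη'
  have hCη'0 : 0 < Cη' := by positivity
  set E : ℕ → ℝ := fun t => Real.log t ^ (ν₀ / 2) * (t : ℝ) ^ (-ν / 2) with hE
  set Λ : ℕ → ℝ := fun t => Real.log t ^ (1 / 2 : ℝ) * (t : ℝ) ^ (1 / 2 - β) with hΛ
  set η : ℕ → ℝ := fun t => Cη' * E t + Cη * (t : ℝ) ^ (β - 1) with hη
  -- the limits
  have hE0 : Tendsto E atTop (nhds 0) := by
    have := OnlineSCI.tendsto_log_rpow_mul_rpow_neg (ν₀ / 2) (s := ν / 2) (by linarith [hν.1])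
    simpa only [hE, neg_div] using this
  have hΛ0 : Tendsto Λ atTop (nhds 0) := by
    have := OnlineSCI.tendsto_log_rpow_mul_rpow_neg (1 / 2) (s := β - 1 / 2) (by linarith [hβ.1])
    simpa only [hΛ, neg_sub] using this
  have hη0 : Tendsto η atTop (nhds 0) := by
    have h1 := OnlineSCI.tendsto_natCast_rpow_neg (s := 1 - β) (by linarith [hβ.2])
    simp only [neg_sub] at h1
    simpa using (hE0.const_mul Cη').add (h1.const_mul Cη)
  have hCE0 : Tendsto (fun t => Cε * E t) atTop (nhds 0) := by simpa using hE0.const_mul Cε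
  obtain ⟨N, hN⟩ := eventually_atTop.1 hest_rate
  have hev : ∀ᶠ t : ℕ in atTop, Cε * E t ≤ 1 ∧ (2 * M + 1) * (Cε * E t) ≤ h₀ / 2 ∧ η t ≤ r ∧
      m * η t / 2 ≤ 1 - α ∧ 4 * Cρ * Λ t ≤ 1 ∧ 8 ≤ t ∧ 4 * (N + t₀) ≤ t := by
    have h1 : Tendsto (fun t => (2 * M + 1) * (Cε * E t)) atTop (nhds 0) := by
      simpa using hCE0.const_mul (2 * M + 1)
    have h2 : Tendsto (fun t => m * η t / 2) atTop (nhds 0) := by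
      simpa using (hη0.const_mul m).div_const 2
    have h3 : Tendsto (fun t => 4 * Cρ * Λ t) atTop (nhds 0) := by
      simpa using hΛ0.const_mul (4 * Cρ)
    filter_upwards [hCE0.eventually_le_const one_pos,
      h1.eventually_le_const (half_pos hh), hη0.eventually_le_const hr,
      h2.eventually_le_const (sub_pos.2 hα.2), h3.eventually_le_const one_pos,
      eventually_ge_atTop 8, eventually_ge_atTop (4 * (N + t₀))] with t a1 a2 a3 a4 a5 a6 a7
    exact ⟨a1, a2, a3, a4, a5, a6, a7⟩
  obtain ⟨T₀, hT₀⟩ := eventually_atTop.1 hev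
  set Cd : ℝ := (1 + 2 / h₀ * M) * (Cη' + Cη + Cρ + 4 * Cρ) + 2 / h₀ * ((2 * M + 3) * Cε) with hCd
  -- The three terms pay for inaccurate scores, selection noise and step noise.
  set Cp : ℝ := 512 + 512 / h₀ ^ 2 + 2 with hCp
  have hCd0 : 0 < Cd := by positivity
  have hCp0 : 0 < Cp := by positivity
  refine ⟨max T₀ 1, le_max_right _ _, Cd + Cp, by positivity, fun t ht => ?_⟩
  obtain ⟨a1, a2, a3, a4, a5, ht8, htN⟩ := hT₀ t ((le_max_left _ _).trans ht)
  have ht0 : (0 : ℝ) < t := by exact_mod_cast (by omega : 0 < t)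
  have hlog : 1 ≤ Real.log t := OnlineSCI.one_le_log_natCast (by omega)
  have hEpos : 0 < E t := by simp only [hE]; positivity
  have hΛpos : 0 < Λ t := by simp only [hΛ]; positivity
  have hτpos : 0 < (t : ℝ) ^ (β - 1) := by positivity
  have hηpos : 0 < η t := by simp only [hη]; positivity
  have hsqrt : √((Cε * E t) ^ 2) = Cε * E t := Real.sqrt_sq (by positivity)
  have hD : 4 * (Cρ * (t : ℝ) ^ (-β)) * √(t * Real.log t) = 4 * Cρ * Λ t := by
    have := OnlineSCI.sqrt_mul_log_eq (β := β) (t := t) (by omega)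
    simp only [hΛ]
    rw [← this]
    ring
  have h8 := OnlineSCI.eighth_le_natCast_div_four ht8
  have hs4 : (0 : ℝ) < ((t / 4 : ℕ) : ℝ) := lt_of_lt_of_le (by positivity) h8
  have hbound := hmod.measure_far_le (α := α) (γ := γ) (q₁ := q₁) hM0.le hM hα hq₁ hγc hq₀' hm hlip
    hzero hdrift hh hh₀ (s := t / 4) (t := t) (t₀ := t₀) (by omega) (by omega) (by omega)
    (ε := (Cε * E t) ^ 2) (η := η t) (p := 512 / (t : ℝ) ^ 3) (ρ := Cρ * (t : ℝ) ^ (-β))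
    (g := c * (t : ℝ) ^ (-β)) (by positivity)
    (pow_le_one₀ (by positivity) a1) (by rw [hsqrt]; exact a2) (by positivity)
    (fun i hi => by
      have hpos : (0 : ℝ) < i := (mul_pos (by positivity) hs4).trans_le hi
      rw [hγ i (by exact_mod_cast hpos)]
      -- From `⌊t/4⌋ ≥ t/8` the counter is at least `h₀ / 32 * t`, which is the origin of `Cρ`.
      refine OnlineSCI.mul_rpow_neg_le_of_le hc.le hβ0.le ht0 (by positivity) (le_trans ?_ hi)
      calc h₀ / 32 * t = h₀ / 4 * (t / 8) := by ring
        _ ≤ _ := mul_le_mul_of_nonneg_left h8 (by positivity))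
    (fun i hi hit => by
      rw [hγ i hi]
      exact mul_le_mul_of_nonneg_left (Real.rpow_le_rpow_of_nonpos (by exact_mod_cast hi)
        (by exact_mod_cast hit) (by linarith)) hc.le)
    (by positivity) ⟨hηpos, a3⟩
    (by
      rw [hsqrt]
      have e : m * η t / 2 = (2 * M + 3) * (Cε * E t) + m * (Cη * (t : ℝ) ^ (β - 1)) / 2 := by
        simp only [hη, hCη']
        field_simp
      have : 0 ≤ m * (Cη * (t : ℝ) ^ (β - 1)) / 2 := by positivity
      linarith)
    a4
    (by
      rw [hD]
      have e1 : Cη * (t : ℝ) ^ (β - 1) ≤ η t := by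
        have : 0 ≤ Cη' * E t := by positivity
        simp only [hη]; linarith
      have e2 : (t : ℝ) ^ (-β) * (t : ℝ) ^ (β - 1) * t = 1 := by
        rw [← Real.rpow_add ht0, show -β + (β - 1) = -1 by ring, Real.rpow_neg_one,
          inv_mul_cancel₀ ht0.ne']
      calc 1 + c + 4 * Cρ * Λ t ≤ 2 + c := by linarith
        _ = c * m * Cη / 4 * ((t : ℝ) ^ (-β) * (t : ℝ) ^ (β - 1) * t) := by
          rw [e2, hCη]; field_simp
        _ = c * (t : ℝ) ^ (-β) * (m * (Cη * (t : ℝ) ^ (β - 1)) / 2) * (t / 2) := by ring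
        _ ≤ _ := by
          refine mul_le_mul ?_ (OnlineSCI.half_le_natCast_sub t) (by positivity) (by positivity)
          gcongr)
    (fun k hk => by
      obtain ⟨hk1, hk2⟩ := Finset.mem_Icc.1 hk
      refine le_trans (measureReal_mono fun ω hω => ?_)
        ((hN k (by omega)).trans (OnlineSCI.three_div_le ht8 hk1))
      exact (OnlineSCI.log_rpow_mul_rpow_le hC₁.le hν₀.le hν.1.le ht8 hk1 hk2).trans hω)
  rw [hsqrt, hD] at hbound
  set R : ℝ := OnlineSCI.rho β t + E t with hR
  have hRle : (1 + 2 / h₀ * M) * (η t + Cρ * (t : ℝ) ^ (-β) + 4 * Cρ * Λ t)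
      + 2 / h₀ * ((2 * M + 3) * (Cε * E t)) ≤ (Cd + Cp) * R := by
    have hRe : R = Λ t + (t : ℝ) ^ (β - 1) + E t := rfl
    have r1 : E t ≤ R := by linarith
    have r2 : (t : ℝ) ^ (β - 1) ≤ R := by linarith
    have r3 : Λ t ≤ R := by linarith
    have r4 : (t : ℝ) ^ (-β) ≤ R := (OnlineSCI.rpow_neg_le_rho (by omega)).trans r3
    have hR0 : 0 ≤ R := hEpos.le.trans r1
    have s1 : η t ≤ (Cη' + Cη) * R := by
      have := mul_le_mul_of_nonneg_left r1 hCη'0.le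
      have := mul_le_mul_of_nonneg_left r2 hCη0.le
      simp only [hη]; linarith
    have s2 := mul_le_mul_of_nonneg_left r4 hCρ0.le
    have s3 := mul_le_mul_of_nonneg_left r3 (by positivity : 0 ≤ 4 * Cρ)
    calc _ ≤ (1 + 2 / h₀ * M) * ((Cη' + Cη) * R + Cρ * R + 4 * Cρ * R)
          + 2 / h₀ * ((2 * M + 3) * (Cε * R)) := by gcongr
      _ = Cd * R := by rw [hCd]; ring
      _ ≤ _ := mul_le_mul_of_nonneg_right (le_add_of_nonneg_right hCp0.le) hR0
  have hA : μ.real {ω | ∃ T, t₀ ≤ T ∧ b < OnlineSCI.threshold α γ q₁ est X Y T ω} < δ' :=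
    lt_of_le_of_lt (measureReal_mono (by
      rintro ω ⟨T, hT, hT'⟩
      exact ⟨T, hT, (le_max_left _ _).trans_lt hT'⟩)) hlt
  have hp1 : ((t - t / 4 + 1 : ℕ) : ℝ) * (512 / (t : ℝ) ^ 3) ≤ 512 / t := by
    have h1 : ((t - t / 4 + 1 : ℕ) : ℝ) ≤ t := by exact_mod_cast (by omega : t - t / 4 + 1 ≤ t)
    have ht1 : (1 : ℝ) ≤ t := by exact_mod_cast (by omega : 1 ≤ t)
    calc _ ≤ (t : ℝ) * (512 / (t : ℝ) ^ 3) := mul_le_mul_of_nonneg_right h1 (by positivity)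
      _ = 512 / (t * t) := by field_simp
      _ ≤ 512 / (1 * t) := by gcongr
      _ = _ := by rw [one_mul]
  have hp2 : 64 / (h₀ ^ 2 * ((t / 4 : ℕ) : ℝ)) ≤ 512 / h₀ ^ 2 / t := by
    calc _ ≤ 64 / (h₀ ^ 2 * ((t : ℝ) / 8)) := by gcongr
      _ = _ := by field_simp; norm_num
  have hp : 512 / (t : ℝ) + 512 / h₀ ^ 2 / t + 2 / t ≤ (Cd + Cp) / t := by
    rw [← add_div, ← add_div]
    exact div_le_div_of_nonneg_right (by rw [hCp]; linarith) ht0.le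
  set G : Set Ω := {ω | |OnlineSCI.instErrorRate μ D0 est X Y
    (OnlineSCI.threshold α γ q₁ est X Y) t ω - α|
      + |OnlineSCI.threshold α γ q₁ est X Y t ω - q₀| ≤ (Cd + Cp) * R} with hG
  have hcompl := (measureReal_mono (μ := μ) (s₁ := Gᶜ) fun ω hω hle => hω
    (le_trans hle hRle)).trans hbound
  -- Subadditivity suffices here, so measurability of `G` is not needed.
  have htot : 1 ≤ μ.real G + μ.real Gᶜ := by
    have := measureReal_union_le (μ := μ) G Gᶜ
    rwa [union_compl_self, probReal_univ] at this
  change 1 - δ' - (Cd + Cp) / t ≤ μ.real G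
  linarith
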